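/- Let $n\ge 2$ and work over $\mathbb{C}$. A codimension two linear space in $\mathbb{P}^n$ is the projectivization of a linear subspace of codimension two of $\mathbb{C}^{n+1}$; these form the Grassmannian $G(n-2,\mathbb{P}^n)$. A rational normal curve in $\mathbb{P}^n$ is the image of $\mathbb{P}^1$ under $[s:t]\mapsto[\varphi_0(s,t):\dots:\varphi_n(s,t)]$, where $\varphi_0,\dots,\varphi_n$ is a basis of the space of binary forms of degree $n$. A rational normal curve $\mathcal{C}$ and a codimension two linear space $\Lambda$ are called $(n-1)$-secant if $\Lambda\cap\mathcal{C}$ is a set of exactly $n-1$ distinct points. Then there is a non-empty Zariski open subset $U\subset G(n-2,\mathbb{P}^n)^{n+2}\times\mathbb{P}^n$ such that, for every $(\Lambda_1,\dots,\Lambda_{n+2},P)\in U$, there exists a unique rational normal curve in $\mathbb{P}^n$ that passes through $P$ and is $(n-1)$-secant to each of $\Lambda_1,\dots,\Lambda_{n+2}$. -/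

import Mathlib

open scoped Topology

/-- Complex projective space `ℙⁿ`, as its set of (closed) points. -/
abbrev PSpace (n : ℕ) : Type := Projectivization ℂ (Fin (n + 1) → ℂ)

/-- Codimension two linear spaces in `ℙⁿ`: the Grassmannian `G(n-2, ℙⁿ)`, whose elements are the
linear subspaces of codimension two of `ℂⁿ⁺¹`. -/
abbrev CodimTwo (n : ℕ) : Type :=
  {Λ : Submodule ℂ (Fin (n + 1) → ℂ) //
    Module.finrank ℂ ((Fin (n + 1) → ℂ) ⧸ Λ) = 2}

/-- The set of points of `ℙⁿ` lying on a codimension two linear space. -/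
def CodimTwo.points {n : ℕ} (Λ : CodimTwo n) : Set (PSpace n) :=
  {x | x.submodule ≤ Λ.1}

/-- Rational normal curves in `ℙⁿ`: the images of `ℙ¹` under `[s : t] ↦ [φ₀(s,t) : … : φₙ(s,t)]`,
where `φ₀, …, φₙ` are `n + 1` linearly independent binary forms of degree `n`, hence a basis of
`H⁰(ℙ¹, 𝒪(n))`. Such forms have no common zero in `ℙ¹`, so the map is defined everywhere. -/
def IsRationalNormalCurve (n : ℕ) (C : Set (PSpace n)) : Prop :=
  ∃ φ : Fin (n + 1) → MvPolynomial (Fin 2) ℂ,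
    (∀ i, (φ i).IsHomogeneous n) ∧ LinearIndependent ℂ φ ∧
    C = {x | ∃ v : Fin 2 → ℂ, v ≠ 0 ∧
      ∃ h : (fun i => MvPolynomial.eval v (φ i)) ≠ 0,
        x = Projectivization.mk ℂ (fun i => MvPolynomial.eval v (φ i)) h}

/-- `Λ` and `C` are `(n-1)`-secant: `Λ ∩ C` consists of exactly `n - 1` distinct points. -/
def IsSecant {n : ℕ} (Λ : CodimTwo n) (C : Set (PSpace n)) : Prop :=
  (Λ.points ∩ C).encard = ((n - 1 : ℕ) : ℕ∞)

/-- The data space `G(n-2, ℙⁿ)ˡ × ℙⁿ` of `l` codimension two linear spaces and one point. -/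
abbrev Datum (n l : ℕ) : Type := (Fin l → CodimTwo n) × PSpace n

/-- The Zariski topology on the affine space `ℂ^σ`: the sets `{x | p x ≠ 0}`, for polynomials `p`,
form a basis of open sets. -/
@[reducible] def zariskiAffine (σ : Type) : TopologicalSpace (σ → ℂ) :=
  TopologicalSpace.generateFrom
    {S | ∃ p : MvPolynomial σ ℂ, S = {x | MvPolynomial.eval x p ≠ 0}}

/-- Names of the coordinates of a frame: `Sum.inl j` is the `j`-th homogeneous coordinate of the
point, and `Sum.inr (i, k, j)` is the `j`-th coefficient of the `k`-th linear form (`k = 0, 1`)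
defining the `i`-th linear space. -/
abbrev FrameIndex (n l : ℕ) : Type := Fin (n + 1) ⊕ (Fin l × Fin 2 × Fin (n + 1))

/-- The point coordinates in a vector of frame coordinates. -/
def framePoint {n l : ℕ} (x : FrameIndex n l → ℂ) : Fin (n + 1) → ℂ :=
  fun j => x (Sum.inl j)

/-- The `2 × (n+1)` coefficient matrix of the two linear forms attached to the index `i`. -/
def frameForms {n l : ℕ} (x : FrameIndex n l → ℂ) (i : Fin l) :
    Matrix (Fin 2) (Fin (n + 1)) ℂ :=
  Matrix.of fun k j => x (Sum.inr (i, k, j))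

/-- Frames: a nonzero vector of `ℂⁿ⁺¹`, and `l` pairs of linearly independent linear forms. -/
def Frame (n l : ℕ) : Type :=
  {x : FrameIndex n l → ℂ //
    framePoint x ≠ 0 ∧ ∀ i, LinearIndependent ℂ (frameForms x i).row}

theorem finrank_quotient_ker_mulVecLin {n : ℕ} (M : Matrix (Fin 2) (Fin (n + 1)) ℂ)
    (hM : LinearIndependent ℂ M.row) :
    Module.finrank ℂ ((Fin (n + 1) → ℂ) ⧸ LinearMap.ker M.mulVecLin) = 2 := by
  rw [M.mulVecLin.quotKerEquivRange.finrank_eq]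
  simpa [Matrix.rank] using hM.rank_matrix

/-- The datum of a frame: the linear spaces `{F = G = 0}` cut out by the pairs of linear forms,
and the point with the given homogeneous coordinates. -/
noncomputable def Frame.toDatum {n l : ℕ} (x : Frame n l) : Datum n l :=
  (fun i => ⟨LinearMap.ker (frameForms x.1 i).mulVecLin,
      finrank_quotient_ker_mulVecLin _ (x.2.2 i)⟩,
    Projectivization.mk ℂ (framePoint x.1) x.2.1)

/-- The Zariski topology on the data space `G(n-2, ℙⁿ)ˡ × ℙⁿ`, which is the quotient of the space
of frames (a Zariski open subset of an affine space) by the action of `GL₂ˡ × GL₁`: a set of data is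
open if and only if the set of the frames defining its elements is Zariski open. -/
@[reducible] noncomputable def zariskiDatum (n l : ℕ) : TopologicalSpace (Datum n l) :=
  TopologicalSpace.coinduced Frame.toDatum
    (TopologicalSpace.induced Subtype.val (zariskiAffine (FrameIndex n l)))

open scoped Matrix

/-! Write each space as `Λᵢ = {Hᵢ = Gᵢ = 0}` with `Hᵢ` vanishing at `P` and `Gᵢ(P) ≠ 0`, and
parametrize a rational normal curve through `P` by a polynomial vector `φ` of degree `n` with `φ(∞)
= P`. Then `Hᵢ(φ)` has degree at most `n - 1` and `Gᵢ(φ)` has degree `n`. Secancy gives them `n - 1`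
distinct common roots, which forces `(X - τᵢ) Hᵢ(φ) = μᵢ Gᵢ(φ)` with `μᵢ ≠ 0`
(`IsSecant.exists_mul_eq`). Conversely, this identity gives secancy as soon as `Hᵢ(φ)` is separable
(`isSecant_of_mul_eq`).

The `n + 2` forms `Hᵢ` lie in the `n`-dimensional space of forms vanishing at `P`, so they satisfy
two linear relations. Multiplying a relation by `X` and using the independence of the components of
`φ`, one sees that the same coefficients annihilate the forms `τᵢHᵢ + μᵢGᵢ`. These are `2(n + 1)`
linear equations in `2(n + 2)` unknowns, and the two missing equations match the reparametrizations
`t ↦ β + εt` fixing infinity. For general data `τ` and `μ` are therefore unique up to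
reparametrization. The point `φ(t)` is then the kernel of the `n × (n + 1)` matrix with rows `tHⱼ -
τⱼHⱼ - μⱼGⱼ`, `j < n`, so it is given by maximal minors. Conversely, the curve built in this way
from the solution of the system satisfies all `n + 2` identities (`secantCurve_mul_eq`), and
`existsUnique_of_isGeneral` follows.

The conditions collected in `IsGeneral` are non-vanishings of polynomials in the frame coordinates,
which gives openness (`isOpen_setOf_exists_frame`). For non-emptiness, a one-parameter family of
special data joins a member where the curve is visibly good to a member where the linear system is
visibly invertible; a general member has both properties (`exists_isGeneral`). -/

/-! ### Maximal minors and one-dimensional kernels -/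

/-- The signed maximal minors of an `n × (n + 1)` matrix. -/
def maximalMinors {R : Type*} [CommRing R] {n : ℕ} (T : Matrix (Fin n) (Fin (n + 1)) R) :
    Fin (n + 1) → R :=
  fun k => (-1) ^ (k : ℕ) * (T.submatrix id k.succAbove).det

/-- The square matrix with rows `r, T₀, …, Tₙ₋₁`. -/
def consRow {R : Type*} {n : ℕ} (r : Fin (n + 1) → R) (T : Matrix (Fin n) (Fin (n + 1)) R) :
    Matrix (Fin (n + 1)) (Fin (n + 1)) R :=
  fun i => Fin.cases r (fun j => T j) i

theorem dotProduct_maximalMinors {R : Type*} [CommRing R] {n : ℕ}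
    (r : Fin (n + 1) → R) (T : Matrix (Fin n) (Fin (n + 1)) R) :
    r ⬝ᵥ maximalMinors T = (consRow r T).det := by
  rw [Matrix.det_succ_row_zero]
  refine Finset.sum_congr rfl fun k _ => ?_
  have : (consRow r T).submatrix Fin.succ k.succAbove
      = T.submatrix id k.succAbove := rfl
  rw [this]
  simp only [maximalMinors, consRow, Fin.cases_zero]
  ring

theorem row_dotProduct_maximalMinors {R : Type*} [CommRing R] {n : ℕ}
    (T : Matrix (Fin n) (Fin (n + 1)) R) (i : Fin n) : T i ⬝ᵥ maximalMinors T = 0 := by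
  rw [dotProduct_maximalMinors]
  refine Matrix.det_zero_of_row_eq (i := 0) (j := i.succ) (Fin.succ_ne_zero i).symm rfl

/-- If the `k`-th minor is nonzero, adding the row `eₖ` on top of `T` gives an invertible matrix. A
suitable combination of `w` and the minors is killed by all its rows, hence vanishes. -/
theorem span_eq_span_maximalMinors {K : Type*} [Field K] {n : ℕ}
    {T : Matrix (Fin n) (Fin (n + 1)) K} (hT : maximalMinors T ≠ 0) {w : Fin (n + 1) → K}
    (hw : w ≠ 0) (hTw : ∀ i, T i ⬝ᵥ w = 0) :
    Submodule.span K {w} = Submodule.span K {maximalMinors T} := by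
  obtain ⟨k, hk⟩ := Function.ne_iff.1 hT
  set r : Fin (n + 1) → K := Pi.single k 1
  have hr : r ⬝ᵥ maximalMinors T ≠ 0 := by simpa [r] using hk
  have key : (r ⬝ᵥ w) • maximalMinors T = (r ⬝ᵥ maximalMinors T) • w := by
    rw [← sub_eq_zero]
    refine Matrix.eq_zero_of_mulVec_eq_zero
      (M := consRow r T) ?_ ?_
    · rwa [← dotProduct_maximalMinors]
    · ext i
      refine Fin.cases ?_ (fun i => ?_) i
      · change r ⬝ᵥ _ = _
        simp [dotProduct_sub, mul_comm]
      · change T i ⬝ᵥ _ = _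
        simp [dotProduct_sub, hTw, row_dotProduct_maximalMinors]
  have hrw : r ⬝ᵥ w ≠ 0 := by
    intro h0
    rw [h0, zero_smul] at key
    exact (smul_ne_zero hr hw) key.symm
  rw [← Submodule.span_singleton_smul_eq (IsUnit.mk0 _ hrw) (maximalMinors T), key,
    Submodule.span_singleton_smul_eq (IsUnit.mk0 _ hr)]

theorem maximalMinors_smul {R : Type*} [CommRing R] {n : ℕ} (c : R)
    (T : Matrix (Fin n) (Fin (n + 1)) R) :
    maximalMinors (c • T) = c ^ n • maximalMinors T := by
  ext k
  have : (c • T).submatrix id k.succAbove = c • T.submatrix id k.succAbove := rfl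
  simp only [maximalMinors, this, Matrix.det_smul, Fintype.card_fin, Pi.smul_apply, smul_eq_mul]
  ring

/-! ### Vectors of polynomials and their linear combinations -/

/-- The linear combination `∑ hₖ φₖ` of polynomials. -/
noncomputable def polyDot {n : ℕ} (h : Fin n → ℂ) (φ : Fin n → Polynomial ℂ) : Polynomial ℂ :=
  ∑ k, Polynomial.C (h k) * φ k

/-- The value of a vector of polynomials. -/
def evalVec {n : ℕ} (φ : Fin n → Polynomial ℂ) (t : ℂ) : Fin n → ℂ := fun k => (φ k).eval t

/-- The coefficients of degree `n` of a vector of polynomials. -/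
def leadVec {n : ℕ} (φ : Fin (n + 1) → Polynomial ℂ) : Fin (n + 1) → ℂ := fun k => (φ k).coeff n

theorem eval_polyDot {n : ℕ} (h : Fin n → ℂ) (φ : Fin n → Polynomial ℂ) (t : ℂ) :
    (polyDot h φ).eval t = h ⬝ᵥ evalVec φ t := by
  simp [polyDot, Polynomial.eval_finsetSum, dotProduct, evalVec]

theorem coeff_polyDot {n : ℕ} (h : Fin n → ℂ) (φ : Fin n → Polynomial ℂ) (m : ℕ) :
    (polyDot h φ).coeff m = ∑ k, h k * (φ k).coeff m := by
  simp [polyDot]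

theorem coeff_polyDot_lead {n : ℕ} (h : Fin (n + 1) → ℂ) (φ : Fin (n + 1) → Polynomial ℂ) :
    (polyDot h φ).coeff n = h ⬝ᵥ leadVec φ := by
  simp [coeff_polyDot, dotProduct, leadVec]

theorem polyDot_add {n : ℕ} (g h : Fin n → ℂ) (φ : Fin n → Polynomial ℂ) :
    polyDot (g + h) φ = polyDot g φ + polyDot h φ := by
  simp [polyDot, add_mul, Finset.sum_add_distrib]

theorem polyDot_smul {n : ℕ} (c : ℂ) (h : Fin n → ℂ) (φ : Fin n → Polynomial ℂ) :
    polyDot (c • h) φ = Polynomial.C c * polyDot h φ := by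
  simp [polyDot, Finset.mul_sum, mul_assoc]

theorem polyDot_zero {n : ℕ} (φ : Fin n → Polynomial ℂ) : polyDot 0 φ = 0 := by
  simp [polyDot]

theorem polyDot_sum {n : ℕ} {ι : Type*} (s : Finset ι) (h : ι → Fin n → ℂ)
    (φ : Fin n → Polynomial ℂ) :
    polyDot (∑ i ∈ s, h i) φ = ∑ i ∈ s, polyDot (h i) φ := by
  classical
  induction s using Finset.induction_on with
  | empty => simp [polyDot_zero]
  | insert a s ha ih => rw [Finset.sum_insert ha, Finset.sum_insert ha, polyDot_add, ih]

theorem natDegree_polyDot_le {n m : ℕ} (h : Fin n → ℂ) {φ : Fin n → Polynomial ℂ}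
    (hφ : ∀ k, (φ k).natDegree ≤ m) : (polyDot h φ).natDegree ≤ m :=
  Polynomial.natDegree_sum_le_of_forall_le _ _ fun k _ =>
    (Polynomial.natDegree_C_mul_le _ _).trans (hφ k)

theorem polyDot_eq_zero_iff {n : ℕ} {φ : Fin n → Polynomial ℂ} (hφ : LinearIndependent ℂ φ)
    (h : Fin n → ℂ) : polyDot h φ = 0 ↔ h = 0 := by
  refine ⟨fun h0 => funext ?_, fun h0 => h0 ▸ polyDot_zero φ⟩
  refine Fintype.linearIndependent_iff.1 hφ h ?_
  simpa [polyDot, Polynomial.smul_eq_C_mul] using h0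

theorem linearIndependent_of_polyDot {n : ℕ} {φ : Fin n → Polynomial ℂ}
    (hφ : ∀ h, polyDot h φ = 0 → h = 0) : LinearIndependent ℂ φ := by
  refine Fintype.linearIndependent_iff.2 fun g hg => ?_
  refine congrFun (hφ g ?_)
  simpa [polyDot, Polynomial.smul_eq_C_mul] using hg

theorem exists_polyDot_eq {n : ℕ} {φ : Fin (n + 1) → Polynomial ℂ}
    (hdeg : ∀ k, (φ k).natDegree ≤ n) (hφ : LinearIndependent ℂ φ) {q : Polynomial ℂ}
    (hq : q.natDegree ≤ n) : ∃ c, polyDot c φ = q := by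
  have mem : ∀ p : Polynomial ℂ, p.natDegree ≤ n → p ∈ Polynomial.degreeLT ℂ (n + 1) := by
    intro p hp
    rw [Polynomial.mem_degreeLT]
    exact (Polynomial.degree_le_of_natDegree_le hp).trans_lt (by exact_mod_cast Nat.lt_succ_self n)
  let ψ : Fin (n + 1) → Polynomial.degreeLT ℂ (n + 1) := fun k => ⟨φ k, mem _ (hdeg k)⟩
  have hψ : LinearIndependent ℂ ψ := by
    refine LinearIndependent.of_comp (Polynomial.degreeLT ℂ (n + 1)).subtype ?_
    exact hφ
  have hfin : Module.finrank ℂ (Polynomial.degreeLT ℂ (n + 1)) = n + 1 := by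
    rw [(Polynomial.degreeLTEquiv ℂ (n + 1)).finrank_eq]; simp
  have hspan := hψ.span_eq_top_of_card_eq_finrank' (by simp [hfin])
  have hqm : (⟨q, mem q hq⟩ : Polynomial.degreeLT ℂ (n + 1)) ∈ Submodule.span ℂ (Set.range ψ) :=
    hspan ▸ Submodule.mem_top
  obtain ⟨c, hc⟩ := (Submodule.mem_span_range_iff_exists_fun ℂ).1 hqm
  refine ⟨c, ?_⟩
  have := congrArg Subtype.val hc
  simpa [polyDot, Polynomial.smul_eq_C_mul, ψ] using this

/-- The constant `1` is a combination of the components, so they have no common zero. -/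
theorem evalVec_ne_zero {n : ℕ} {φ : Fin (n + 1) → Polynomial ℂ}
    (hdeg : ∀ k, (φ k).natDegree ≤ n) (hφ : LinearIndependent ℂ φ) (t : ℂ) :
    evalVec φ t ≠ 0 := by
  intro h0
  obtain ⟨c, hc⟩ := exists_polyDot_eq hdeg hφ (q := 1) (by simp)
  have := eval_polyDot c φ t
  simp [hc, h0] at this

/-- Both `1` and `X` are combinations of the components: the first fixes the scalar between the two
vectors, the second reads off the parameter. -/
theorem span_evalVec_injective {n : ℕ} (hn : 1 ≤ n) {φ : Fin (n + 1) → Polynomial ℂ}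
    (hdeg : ∀ k, (φ k).natDegree ≤ n) (hφ : LinearIndependent ℂ φ) {s t : ℂ}
    (hst : Submodule.span ℂ {evalVec φ s} = Submodule.span ℂ {evalVec φ t}) : s = t := by
  obtain ⟨c, hc⟩ := exists_polyDot_eq hdeg hφ (q := 1) (by simp)
  obtain ⟨d, hd⟩ := exists_polyDot_eq hdeg hφ (q := Polynomial.X) (by simpa using hn)
  have hm : evalVec φ s ∈ Submodule.span ℂ {evalVec φ t} :=
    hst ▸ Submodule.mem_span_singleton_self _
  obtain ⟨a, ha⟩ := Submodule.mem_span_singleton.1 hm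
  have h1 := eval_polyDot c φ s
  have h2 := eval_polyDot c φ t
  have h3 := eval_polyDot d φ s
  have h4 := eval_polyDot d φ t
  rw [← ha, dotProduct_smul] at h1 h3
  rw [← h2] at h1
  rw [← h4] at h3
  simp [hc, hd] at h1 h3
  rw [h3, ← h1, one_mul]

/-! ### Affine parametrizations of rational normal curves -/

/-- The curve with affine parametrization `φ`, together with the point `[p]` at infinity. -/
def ratCurve {n : ℕ} (p : Fin (n + 1) → ℂ) (φ : Fin (n + 1) → Polynomial ℂ) : Set (PSpace n) :=
  {x | x.submodule = Submodule.span ℂ {p} ∨ ∃ t, x.submodule = Submodule.span ℂ {evalVec φ t}}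

theorem eq_mk_iff {n : ℕ} {x : PSpace n} {v : Fin (n + 1) → ℂ} :
    (∃ h : v ≠ 0, x = Projectivization.mk ℂ v h) ↔ x.submodule = Submodule.span ℂ {v} := by
  constructor
  · rintro ⟨h, rfl⟩
    exact Projectivization.submodule_mk _ _
  · intro h
    have hv : v ≠ 0 := by
      rintro rfl
      have := x.finrank_submodule
      rw [h, Submodule.span_zero_singleton, finrank_bot] at this
      exact zero_ne_one this
    exact ⟨hv, Projectivization.submodule_injective (by rw [h, Projectivization.submodule_mk])⟩

theorem eval_smul_of_isHomogeneous {σ : Type*} {q : MvPolynomial σ ℂ} {n : ℕ}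
    (hq : q.IsHomogeneous n) (c : ℂ) (v : σ → ℂ) :
    MvPolynomial.eval (c • v) q = c ^ n * MvPolynomial.eval v q := by
  rw [MvPolynomial.eval_eq, MvPolynomial.eval_eq, Finset.mul_sum]
  refine Finset.sum_congr rfl fun d hd => ?_
  have hdn : ∑ i ∈ d.support, d i = n := by
    have := hq (MvPolynomial.mem_support_iff.1 hd)
    simpa [Finsupp.weight_apply, Finsupp.sum] using this
  simp only [Pi.smul_apply, smul_eq_mul, mul_pow, Finset.prod_mul_distrib,
    Finset.prod_pow_eq_pow_sum, hdn]
  ring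

theorem eval_homogenize_of_ne_zero {p : Polynomial ℂ} {n : ℕ} (hp : p.natDegree ≤ n)
    {v : Fin 2 → ℂ} (hv : v 1 ≠ 0) :
    MvPolynomial.eval v (p.homogenize n) = v 1 ^ n * p.eval (v 0 / v 1) := by
  have h1 : v = v 1 • ![v 0 / v 1, 1] := by
    ext i; fin_cases i <;> simp [mul_div_cancel₀, hv]
  have h2 := Polynomial.eval₂_homogenize_of_eq_one hp (RingHom.id ℂ) ![v 0 / v 1, 1] rfl
  conv_lhs => rw [h1]
  rw [eval_smul_of_isHomogeneous (Polynomial.isHomogeneous_homogenize p)]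
  congr 1

theorem eval_homogenize_of_eq_zero (p : Polynomial ℂ) (n : ℕ) {v : Fin 2 → ℂ} (hv : v 1 = 0) :
    MvPolynomial.eval v (p.homogenize n) = v 0 ^ n * p.coeff n := by
  rw [Polynomial.homogenize, map_sum, Finset.sum_eq_single (n, 0)]
  · simp [MvPolynomial.eval_monomial, Finsupp.prod_fintype, mul_comm]
  · rintro ⟨k, l⟩ hkl hne
    have hl : l ≠ 0 := by
      rintro rfl
      simp at hkl
      exact hne (by rw [hkl])
    simp [MvPolynomial.eval_monomial, Finsupp.prod_fintype, hv, hl]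
  · intro h
    simp at h

theorem setOf_eval_homogenize_eq_ratCurve {n : ℕ} {φ : Fin (n + 1) → Polynomial ℂ}
    (hdeg : ∀ k, (φ k).natDegree ≤ n) :
    {x : PSpace n | ∃ v : Fin 2 → ℂ, v ≠ 0 ∧ x.submodule =
      Submodule.span ℂ {fun k => MvPolynomial.eval v ((φ k).homogenize n)}} =
      ratCurve (leadVec φ) φ := by
  ext x
  constructor
  · rintro ⟨v, hv, hx⟩
    by_cases h1 : v 1 = 0
    · have h0 : v 0 ≠ 0 := by
        intro h0
        exact hv (by ext i; fin_cases i <;> simp [h0, h1])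
      left
      rw [hx, ← Submodule.span_singleton_smul_eq (IsUnit.mk0 _ (pow_ne_zero n h0)) (leadVec φ)]
      congr 2
      ext k
      simp [eval_homogenize_of_eq_zero _ _ h1, leadVec]
    · right
      refine ⟨v 0 / v 1, ?_⟩
      rw [hx, ← Submodule.span_singleton_smul_eq (IsUnit.mk0 _ (pow_ne_zero n h1)) (evalVec φ _)]
      congr 2
      ext k
      simp [eval_homogenize_of_ne_zero (hdeg k) h1, evalVec]
  · rintro (hx | ⟨t, hx⟩)
    · refine ⟨![1, 0], fun h => by simpa using congrFun h 0, hx.trans ?_⟩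
      congr 2
      ext k
      rw [eval_homogenize_of_eq_zero _ _ (by simp)]
      simp [leadVec]
    · refine ⟨![t, 1], fun h => by simpa using congrFun h 1, hx.trans ?_⟩
      congr 2
      ext k
      rw [eval_homogenize_of_ne_zero (hdeg k) (by simp)]
      simp [evalVec]

theorem isRationalNormalCurve_iff_submodule {n : ℕ} {C : Set (PSpace n)} :
    IsRationalNormalCurve n C ↔ ∃ φ : Fin (n + 1) → MvPolynomial (Fin 2) ℂ,
      (∀ i, (φ i).IsHomogeneous n) ∧ LinearIndependent ℂ φ ∧
      C = {x | ∃ v : Fin 2 → ℂ, v ≠ 0 ∧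
        x.submodule = Submodule.span ℂ {fun i => MvPolynomial.eval v (φ i)}} := by
  simp only [IsRationalNormalCurve, eq_mk_iff]

theorem isRationalNormalCurve_ratCurve {n : ℕ} {φ : Fin (n + 1) → Polynomial ℂ}
    (hdeg : ∀ k, (φ k).natDegree ≤ n) (hφ : LinearIndependent ℂ φ) :
    IsRationalNormalCurve n (ratCurve (leadVec φ) φ) := by
  rw [isRationalNormalCurve_iff_submodule]
  refine ⟨fun k => (φ k).homogenize n, fun k => Polynomial.isHomogeneous_homogenize _, ?_,
    (setOf_eval_homogenize_eq_ratCurve hdeg).symm⟩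
  refine Fintype.linearIndependent_iff.2 fun g hg => ?_
  refine Fintype.linearIndependent_iff.1 hφ g ?_
  refine Polynomial.eq_zero_of_homogenize_eq_zero (n := n)
    (Polynomial.natDegree_sum_le_of_forall_le _ _ fun k _ =>
      (Polynomial.natDegree_smul_le _ _).trans (hdeg k)) ?_
  simpa using hg

theorem natDegree_aeval_X_one_le {q : MvPolynomial (Fin 2) ℂ} {n : ℕ} (hq : q.IsHomogeneous n) :
    (MvPolynomial.aeval ![(Polynomial.X : Polynomial ℂ), 1] q).natDegree ≤ n := by
  rw [q.as_sum, map_sum]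
  refine Polynomial.natDegree_sum_le_of_forall_le _ _ fun d hd => ?_
  rw [MvPolynomial.aeval_monomial, Finsupp.prod_fintype _ _ (by simp), Fin.prod_univ_two]
  have hdn := hq (MvPolynomial.mem_support_iff.1 hd)
  simp only [Finsupp.weight_apply, Pi.one_apply, smul_eq_mul, mul_one, Finsupp.sum_fintype,
    Fin.sum_univ_two, implies_true] at hdn
  refine (Polynomial.natDegree_C_mul_le _ _).trans ?_
  simp
  omega

/-- A rational normal curve has an affine parametrization sending infinity to a given point. -/
theorem IsRationalNormalCurve.exists_param {n : ℕ} {C : Set (PSpace n)}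
    (hC : IsRationalNormalCurve n C) {P : PSpace n} (hP : P ∈ C) :
    ∃ φ : Fin (n + 1) → Polynomial ℂ, (∀ k, (φ k).natDegree ≤ n) ∧ LinearIndependent ℂ φ ∧
      P.submodule = Submodule.span ℂ {leadVec φ} ∧ C = ratCurve (leadVec φ) φ := by
  obtain ⟨ψ, hψ, hli, rfl⟩ := isRationalNormalCurve_iff_submodule.1 hC
  obtain ⟨v₀, hv₀, hP⟩ := hP
  -- Completing the parameter `v₀` of `P` to a basis gives a linear change of parameters that moves
  -- `P` to `[1 : 0]`, the point at infinity.
  obtain ⟨w₀, hdet⟩ : ∃ w₀ : Fin 2 → ℂ, v₀ 0 * w₀ 1 - v₀ 1 * w₀ 0 ≠ 0 := by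
    by_cases h0 : v₀ 0 = 0
    · refine ⟨![1, 0], fun h => hv₀ ?_⟩
      ext i; fin_cases i
      · simpa using h0
      · simpa [h0] using h
    · exact ⟨![0, 1], by simpa using h0⟩
  let s : Fin 2 → MvPolynomial (Fin 2) ℂ := fun k =>
    MvPolynomial.C (v₀ k) * MvPolynomial.X 0 + MvPolynomial.C (w₀ k) * MvPolynomial.X 1
  have hs : ∀ k, (s k).IsHomogeneous 1 := fun k =>
    (MvPolynomial.isHomogeneous_C_mul_X _ _).add (MvPolynomial.isHomogeneous_C_mul_X _ _)
  have hψs : ∀ i, (MvPolynomial.aeval s (ψ i)).IsHomogeneous n := fun i => by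
    simpa using (hψ i).aeval s hs
  let φ : Fin (n + 1) → Polynomial ℂ := fun i =>
    MvPolynomial.aeval ![(Polynomial.X : Polynomial ℂ), 1] (MvPolynomial.aeval s (ψ i))
  have hdeg : ∀ i, (φ i).natDegree ≤ n := fun i => natDegree_aeval_X_one_le (hψs i)
  have hhom : ∀ i, (φ i).homogenize n = MvPolynomial.aeval s (ψ i) := fun i =>
    Polynomial.homogenize_eq_of_isHomogeneous (hψs i) rfl
  have heval : ∀ (u : Fin 2 → ℂ) (q : MvPolynomial (Fin 2) ℂ),
      MvPolynomial.eval u (MvPolynomial.aeval s q) =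
        MvPolynomial.eval (u 0 • v₀ + u 1 • w₀) q := by
    intro u q
    rw [MvPolynomial.aeval_eq_bind₁, MvPolynomial.eval, MvPolynomial.eval₂Hom_bind₁]
    congr 2
    ext k
    simp [s, mul_comm]
  have hsurj : ∀ v : Fin 2 → ℂ, ∃ u : Fin 2 → ℂ, u 0 • v₀ + u 1 • w₀ = v := by
    intro v
    refine ⟨![(v 0 * w₀ 1 - v 1 * w₀ 0) / (v₀ 0 * w₀ 1 - v₀ 1 * w₀ 0),
      (v₀ 0 * v 1 - v₀ 1 * v 0) / (v₀ 0 * w₀ 1 - v₀ 1 * w₀ 0)], ?_⟩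
    ext k
    fin_cases k <;>
    · simp only [Pi.add_apply, Pi.smul_apply, smul_eq_mul, Matrix.cons_val_zero,
        Matrix.cons_val_one, Fin.zero_eta, Fin.mk_one, div_mul_eq_mul_div]
      rw [← add_div, div_eq_iff hdet]
      ring
  have hinj : ∀ u : Fin 2 → ℂ, u ≠ 0 → u 0 • v₀ + u 1 • w₀ ≠ 0 := by
    intro u hu h
    have h0 := congrFun h 0
    have h1 := congrFun h 1
    simp at h0 h1
    refine hu ?_
    ext k
    fin_cases k
    · refine (mul_eq_zero.1 (?_ : u 0 * (v₀ 0 * w₀ 1 - v₀ 1 * w₀ 0) = 0)).resolve_right hdet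
      linear_combination w₀ 1 * h0 - w₀ 0 * h1
    · refine (mul_eq_zero.1 (?_ : u 1 * (v₀ 0 * w₀ 1 - v₀ 1 * w₀ 0) = 0)).resolve_right hdet
      linear_combination v₀ 0 * h1 - v₀ 1 * h0
  refine ⟨φ, hdeg, ?_, ?_, ?_⟩
  · refine Fintype.linearIndependent_iff.2 fun g hg => ?_
    refine Fintype.linearIndependent_iff.1 hli g ?_
    refine MvPolynomial.funext fun v => ?_
    obtain ⟨u, rfl⟩ := hsurj v
    rw [← heval, map_sum, map_sum]
    have : ∑ i, g i • MvPolynomial.aeval s (ψ i) = 0 := by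
      rw [← Polynomial.homogenize_zero (R := ℂ) n, ← hg]
      simp [hhom]
    have := congrArg (MvPolynomial.eval u) this
    simpa using this
  · rw [hP]
    congr 2
    ext k
    have := heval ![1, 0] (ψ k)
    rw [← hhom, eval_homogenize_of_eq_zero _ _ (by simp)] at this
    simpa [leadVec] using this.symm
  · rw [← setOf_eval_homogenize_eq_ratCurve hdeg]
    ext x
    simp only [hhom, heval, Set.mem_ofPred_eq]
    constructor
    · rintro ⟨v, hv, hx⟩
      obtain ⟨u, rfl⟩ := hsurj v
      exact ⟨u, by rintro rfl; simp at hv, hx⟩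
    · rintro ⟨u, hu, hx⟩
      exact ⟨_, hinj u hu, hx⟩

/-! ### Secancy as a polynomial identity -/

/-- Since `G` does not vanish at the point at infinity, all intersections lie on the affine part,
where the parametrization is injective. -/
theorem encard_points_inter_ratCurve {n : ℕ} (hn : 1 ≤ n) {φ : Fin (n + 1) → Polynomial ℂ}
    (hdeg : ∀ k, (φ k).natDegree ≤ n) (hφ : LinearIndependent ℂ φ) {Λ : CodimTwo n}
    {H G : Fin (n + 1) → ℂ} (hΛ : ∀ v, v ∈ Λ.1 ↔ H ⬝ᵥ v = 0 ∧ G ⬝ᵥ v = 0)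
    (hG : G ⬝ᵥ leadVec φ ≠ 0) :
    (Λ.points ∩ ratCurve (leadVec φ) φ).encard =
      {t | (polyDot H φ).eval t = 0 ∧ (polyDot G φ).eval t = 0}.encard := by
  let F : ℂ → PSpace n := fun t => Projectivization.mk ℂ (evalVec φ t) (evalVec_ne_zero hdeg hφ t)
  have hF : Function.Injective F := by
    intro s t hst
    refine span_evalVec_injective hn hdeg hφ ?_
    have := congrArg Projectivization.submodule hst
    simpa only [F, Projectivization.submodule_mk] using this
  rw [← hF.encard_image]
  congr 1
  ext x
  simp only [Set.mem_inter_iff, CodimTwo.points, ratCurve, Set.mem_ofPred_eq, Set.mem_image,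
    eval_polyDot]
  constructor
  · rintro ⟨h1, h2 | ⟨t, h2⟩⟩
    · rw [h2, Submodule.span_singleton_le_iff_mem, hΛ] at h1
      exact absurd h1.2 hG
    · rw [h2, Submodule.span_singleton_le_iff_mem, hΛ] at h1
      refine ⟨t, h1, Projectivization.submodule_injective ?_⟩
      rw [h2, Projectivization.submodule_mk]
  · rintro ⟨t, ht, rfl⟩
    rw [Projectivization.submodule_mk, Submodule.span_singleton_le_iff_mem, hΛ]
    exact ⟨ht, Or.inr ⟨t, rfl⟩⟩

/-- Secancy forces the projection from `Λ` to restrict to an isomorphism of the curve with `ℙ¹`. -/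
theorem IsSecant.exists_mul_eq {n : ℕ} (hn : 1 ≤ n) {φ : Fin (n + 1) → Polynomial ℂ}
    (hdeg : ∀ k, (φ k).natDegree ≤ n) (hφ : LinearIndependent ℂ φ) {Λ : CodimTwo n}
    {H G : Fin (n + 1) → ℂ} (hΛ : ∀ v, v ∈ Λ.1 ↔ H ⬝ᵥ v = 0 ∧ G ⬝ᵥ v = 0)
    (hG : G ⬝ᵥ leadVec φ ≠ 0) (hH : H ⬝ᵥ leadVec φ = 0) (hH0 : H ≠ 0)
    (hsec : IsSecant Λ (ratCurve (leadVec φ) φ)) :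
    ∃ τ μ : ℂ, μ ≠ 0 ∧
      (Polynomial.X - Polynomial.C τ) * polyDot H φ = Polynomial.C μ * polyDot G φ := by
  rw [IsSecant, encard_points_inter_ratCurve hn hdeg hφ hΛ hG] at hsec
  set f := polyDot H φ with hf
  set g := polyDot G φ with hg
  have hf0 : f ≠ 0 := fun h => hH0 ((polyDot_eq_zero_iff hφ H).1 h)
  have hfn : f.coeff n = 0 := by rw [hf, coeff_polyDot_lead, hH]
  have hgn : g.coeff n ≠ 0 := by rwa [hg, coeff_polyDot_lead]
  have hfd : f.natDegree ≤ n - 1 := by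
    have h1 : f.natDegree ≤ n := natDegree_polyDot_le H hdeg
    have h2 : f.natDegree ≠ n := by
      intro h
      rw [← h, Polynomial.coeff_natDegree, Polynomial.leadingCoeff_eq_zero] at hfn
      exact hf0 hfn
    omega
  have hgd : g.natDegree = n :=
    le_antisymm (natDegree_polyDot_le G hdeg) (Polynomial.le_natDegree_of_ne_zero hgn)
  have hg0 : g ≠ 0 := by rintro h; simp [h] at hgn
  have hfin : {t | f.eval t = 0 ∧ g.eval t = 0}.Finite := Set.finite_of_encard_eq_coe hsec
  set s := hfin.toFinset with hs
  have hcard : s.card = n - 1 := by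
    rw [hfin.encard_eq_coe_toFinset_card] at hsec
    exact_mod_cast hsec
  -- The product over the `n - 1` common zeros divides both polynomials; by degree, its cofactor in
  -- `f` is a constant `l` and its cofactor in `g` is linear, `cX + d`.
  set h : Polynomial ℂ := ∏ t ∈ s, (Polynomial.X - Polynomial.C t) with hh
  have hcop : (s : Set ℂ).Pairwise
      (Function.onFun IsCoprime fun t : ℂ => Polynomial.X - Polynomial.C t) :=
    fun a _ b _ hab => Polynomial.pairwise_coprime_X_sub_C Function.injective_id hab
  have hhf : h ∣ f := Finset.prod_dvd_of_coprime hcop fun t ht =>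
    Polynomial.dvd_iff_isRoot.2 (hfin.mem_toFinset.1 ht).1
  have hhg : h ∣ g := Finset.prod_dvd_of_coprime hcop fun t ht =>
    Polynomial.dvd_iff_isRoot.2 (hfin.mem_toFinset.1 ht).2
  have hhd : h.natDegree = n - 1 := by
    rw [hh, Polynomial.natDegree_finsetProd_X_sub_C_eq_card, hcard]
  obtain ⟨a, ha⟩ := hhf
  obtain ⟨b, hb⟩ := hhg
  have ha0 : a ≠ 0 := by rintro rfl; exact hf0 (by rw [ha, mul_zero])
  have hb0 : b ≠ 0 := by rintro rfl; exact hg0 (by rw [hb, mul_zero])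
  have hh0 : h ≠ 0 := by intro h0; exact hf0 (by rw [ha, h0, zero_mul])
  have had : a.natDegree = 0 := by
    have := Polynomial.natDegree_mul hh0 ha0
    rw [← ha] at this
    omega
  have hbd : b.natDegree = 1 := by
    have := Polynomial.natDegree_mul hh0 hb0
    rw [← hb] at this
    omega
  obtain ⟨l, rfl⟩ := Polynomial.natDegree_eq_zero.1 had
  have hl : l ≠ 0 := by rintro rfl; simp at ha0
  obtain ⟨c, hc, d, rfl⟩ := Polynomial.natDegree_eq_one.1 hbd
  refine ⟨-(d / c), l / c, div_ne_zero hl hc, ?_⟩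
  rw [ha, hb]
  have e1 : (Polynomial.C l : Polynomial ℂ) = Polynomial.C (l / c) * Polynomial.C c := by
    rw [← Polynomial.C_mul, div_mul_cancel₀ _ hc]
  have e2 : (Polynomial.C d : Polynomial ℂ) = Polynomial.C (d / c) * Polynomial.C c := by
    rw [← Polynomial.C_mul, div_mul_cancel₀ _ hc]
  rw [e1, e2, Polynomial.C_neg]
  ring

theorem natDegree_of_mul_eq {n : ℕ} {φ : Fin (n + 1) → Polynomial ℂ}
    (hdeg : ∀ k, (φ k).natDegree ≤ n) {H G : Fin (n + 1) → ℂ} (hG : G ⬝ᵥ leadVec φ ≠ 0)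
    {τ μ : ℂ} (hμ : μ ≠ 0)
    (h : (Polynomial.X - Polynomial.C τ) * polyDot H φ = Polynomial.C μ * polyDot G φ) :
    (polyDot H φ).natDegree = n - 1 ∧ polyDot H φ ≠ 0 := by
  have hgn : (polyDot G φ).coeff n ≠ 0 := by rwa [coeff_polyDot_lead]
  have hgd : (polyDot G φ).natDegree = n :=
    le_antisymm (natDegree_polyDot_le G hdeg) (Polynomial.le_natDegree_of_ne_zero hgn)
  have hf0 : polyDot H φ ≠ 0 := by
    intro h0
    rw [h0, mul_zero] at h
    have := congrArg (fun p => Polynomial.coeff p n) h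
    simp [hμ, hgn] at this
  refine ⟨?_, hf0⟩
  have := congrArg Polynomial.natDegree h
  rw [Polynomial.natDegree_mul (Polynomial.X_sub_C_ne_zero _) hf0, Polynomial.natDegree_X_sub_C,
    Polynomial.natDegree_C_mul hμ, hgd] at this
  omega

/-- By the identity, every zero of `H(φ)` is a zero of `G(φ)`, and a separable polynomial of degree
`n - 1` has `n - 1` distinct zeros. -/
theorem isSecant_of_mul_eq {n : ℕ} (hn : 1 ≤ n) {φ : Fin (n + 1) → Polynomial ℂ}
    (hdeg : ∀ k, (φ k).natDegree ≤ n) (hφ : LinearIndependent ℂ φ) {Λ : CodimTwo n}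
    {H G : Fin (n + 1) → ℂ} (hΛ : ∀ v, v ∈ Λ.1 ↔ H ⬝ᵥ v = 0 ∧ G ⬝ᵥ v = 0)
    (hG : G ⬝ᵥ leadVec φ ≠ 0) {τ μ : ℂ} (hμ : μ ≠ 0)
    (h : (Polynomial.X - Polynomial.C τ) * polyDot H φ = Polynomial.C μ * polyDot G φ)
    (hsep : (polyDot H φ).Separable) :
    IsSecant Λ (ratCurve (leadVec φ) φ) := by
  obtain ⟨hd, h0⟩ := natDegree_of_mul_eq hdeg hG hμ h
  rw [IsSecant, encard_points_inter_ratCurve hn hdeg hφ hΛ hG]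
  have hset : {t | (polyDot H φ).eval t = 0 ∧ (polyDot G φ).eval t = 0} =
      ((polyDot H φ).roots.toFinset : Set ℂ) := by
    ext t
    simp only [Set.mem_ofPred_eq, Finset.mem_coe, Multiset.mem_toFinset, Polynomial.mem_roots h0,
      Polynomial.IsRoot.def, and_iff_left_iff_imp]
    intro ht
    have := congrArg (Polynomial.eval t) h
    simpa [ht, hμ] using this
  rw [hset, Set.encard_coe_eq_coe_finsetCard, Multiset.toFinset_card_of_nodup
    (Polynomial.nodup_roots hsep), IsAlgClosed.card_roots_eq_natDegree, hd]

/-- In characteristic zero the formal sizes `m` and `m - 1` are the true degrees, so the resultant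
detects coprimality of `f` and its derivative. -/
theorem resultant_derivative_ne_zero_iff {f : Polynomial ℂ} {m : ℕ} (hf : f.natDegree = m)
    (hf0 : f ≠ 0) :
    f.resultant f.derivative m (m - 1) ≠ 0 ↔ f.Separable := by
  subst hf
  rw [← Polynomial.natDegree_derivative, Ne, Polynomial.resultant_eq_zero_iff]
  simp [hf0, Polynomial.Separable]

/-! ### Pencils of matrices -/

/-- The curve swept out by the kernels of the pencil of matrices `tA + B`. -/
noncomputable def pencilCurve {n : ℕ} (A B : Matrix (Fin n) (Fin (n + 1)) ℂ) :
    Fin (n + 1) → Polynomial ℂ :=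
  maximalMinors ((Polynomial.X : Polynomial ℂ) • A.map Polynomial.C + B.map Polynomial.C)

theorem pencilCurve_apply {n : ℕ} (A B : Matrix (Fin n) (Fin (n + 1)) ℂ) (k : Fin (n + 1)) :
    pencilCurve A B k = Polynomial.C ((-1) ^ (k : ℕ)) *
      ((Polynomial.X : Polynomial ℂ) • (A.submatrix id k.succAbove).map Polynomial.C +
        (B.submatrix id k.succAbove).map Polynomial.C).det := by
  rw [Polynomial.C_pow, Polynomial.C_neg, Polynomial.C_1]
  rfl

theorem natDegree_pencilCurve_le {n : ℕ} (A B : Matrix (Fin n) (Fin (n + 1)) ℂ) (k : Fin (n + 1)) :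
    (pencilCurve A B k).natDegree ≤ n := by
  rw [pencilCurve_apply]
  refine (Polynomial.natDegree_C_mul_le _ _).trans ?_
  simpa using Polynomial.natDegree_det_X_add_C_le (A.submatrix id k.succAbove)
    (B.submatrix id k.succAbove)

/-- The coefficient of `Xⁿ` in `det (XA + B)` is `det A`: the point at infinity of the curve comes
from the member `A` of the pencil. -/
theorem leadVec_pencilCurve {n : ℕ} (A B : Matrix (Fin n) (Fin (n + 1)) ℂ) :
    leadVec (pencilCurve A B) = maximalMinors A := by
  ext k
  have := Polynomial.coeff_det_X_add_C_card (A.submatrix id k.succAbove)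
    (B.submatrix id k.succAbove)
  rw [Fintype.card_fin] at this
  rw [leadVec, pencilCurve_apply, Polynomial.coeff_C_mul, this, maximalMinors]

theorem evalVec_pencilCurve {n : ℕ} (A B : Matrix (Fin n) (Fin (n + 1)) ℂ) (t : ℂ) :
    evalVec (pencilCurve A B) t = maximalMinors (t • A + B) := by
  ext k
  rw [evalVec, pencilCurve_apply, Polynomial.eval_mul, Polynomial.eval_C, maximalMinors,
    ← Polynomial.coe_evalRingHom, RingHom.map_det]
  congr 2
  ext i j
  simp
  ring

theorem row_pencilCurve {n : ℕ} (A B : Matrix (Fin n) (Fin (n + 1)) ℂ) (j : Fin n) :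
    Polynomial.X * polyDot (A j) (pencilCurve A B) + polyDot (B j) (pencilCurve A B) = 0 := by
  refine Polynomial.funext fun t => ?_
  have h := row_dotProduct_maximalMinors (t • A + B) j
  rw [← evalVec_pencilCurve] at h
  rw [Polynomial.eval_add, Polynomial.eval_mul, Polynomial.eval_X, eval_polyDot, eval_polyDot,
    Polynomial.eval_zero, ← h, ← smul_eq_mul, ← smul_dotProduct, ← add_dotProduct]
  rfl

/-- The matrix of coefficients of a vector of polynomials of degree at most `n`. -/
def coeffMatrix {n : ℕ} (φ : Fin (n + 1) → Polynomial ℂ) : Matrix (Fin (n + 1)) (Fin (n + 1)) ℂ :=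
  fun m k => (φ k).coeff m

/-- Applying the coefficient matrix to `c` lists the coefficients of `polyDot c φ`, so its kernel
consists of the linear relations. -/
theorem det_coeffMatrix_ne_zero_iff {n : ℕ} {φ : Fin (n + 1) → Polynomial ℂ}
    (hdeg : ∀ k, (φ k).natDegree ≤ n) : (coeffMatrix φ).det ≠ 0 ↔ LinearIndependent ℂ φ := by
  have key : ∀ c, coeffMatrix φ *ᵥ c = 0 ↔ polyDot c φ = 0 := by
    intro c
    have h1 : ∀ m : Fin (n + 1), (coeffMatrix φ *ᵥ c) m = (polyDot c φ).coeff m := by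
      intro m
      simp [coeff_polyDot, Matrix.mulVec, dotProduct, coeffMatrix, mul_comm]
    constructor
    · intro h
      ext m
      rcases lt_or_ge m (n + 1) with hm | hm
      · simpa [h] using (h1 ⟨m, hm⟩).symm
      · exact Polynomial.coeff_eq_zero_of_natDegree_lt
          ((natDegree_polyDot_le c hdeg).trans_lt hm)
    · intro h
      ext m
      rw [h1, h]
      rfl
  constructor
  · intro h
    exact linearIndependent_of_polyDot fun c hc =>
      Matrix.eq_zero_of_mulVec_eq_zero h ((key c).2 hc)
  · intro h h0
    obtain ⟨c, hc, hc0⟩ := Matrix.exists_mulVec_eq_zero_iff.2 h0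
    exact hc ((polyDot_eq_zero_iff h c).1 ((key c).1 hc0))

/-! ### The linear system for `τ` and `μ` -/

/-- The first `n` rows of a family of `n + 2` linear forms. -/
def topRows {n : ℕ} (H : Fin (n + 2) → Fin (n + 1) → ℂ) : Matrix (Fin n) (Fin (n + 1)) ℂ :=
  fun j => H (Fin.castAdd 2 j)

/-- The first `n` rows of a family of `n + 2` linear forms, without their first coefficient. -/
def topMinor {n : ℕ} (H : Fin (n + 2) → Fin (n + 1) → ℂ) : Matrix (Fin n) (Fin n) ℂ :=
  fun j k => H (Fin.castAdd 2 j) k.succ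

/-- The coefficients of the linear relation expressing `H (n + r)` through `H 0, …, H (n - 1)`,
when all these forms vanish at a common point. -/
noncomputable def formRelation {n : ℕ} (H : Fin (n + 2) → Fin (n + 1) → ℂ) (r : Fin 2) :
    Fin (n + 2) → ℂ :=
  Fin.addCases (fun j => ((fun k : Fin n => H (Fin.natAdd n r) k.succ) ᵥ* (topMinor H).adjugate) j)
    (fun s => if s = r then -(topMinor H).det else 0)

theorem sum_formRelation_smul {n : ℕ} {M : Type*} [AddCommGroup M] [Module ℂ M]
    (H : Fin (n + 2) → Fin (n + 1) → ℂ) (r : Fin 2) (w : Fin (n + 2) → M) :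
    ∑ i, formRelation H r i • w i =
      ∑ j : Fin n, formRelation H r (Fin.castAdd 2 j) • w (Fin.castAdd 2 j) -
        (topMinor H).det • w (Fin.natAdd n r) := by
  rw [Fin.sum_univ_add, sub_eq_add_neg]
  congr 1
  simp only [formRelation, Fin.addCases_right, ite_smul, zero_smul, Finset.sum_ite_eq',
    Finset.mem_univ, if_true, neg_smul]

/-- Cramer's rule makes the combination vanish in all coordinates but the first, with coefficients
polynomial in `H`. The first coordinate then vanishes because the combination kills `p` and `p 0 ≠
0`. -/
theorem sum_formRelation_eq_zero {n : ℕ} {H : Fin (n + 2) → Fin (n + 1) → ℂ}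
    {p : Fin (n + 1) → ℂ} (hp : p ≠ 0) (hH : ∀ i, H i ⬝ᵥ p = 0) (hD : (topMinor H).det ≠ 0)
    (r : Fin 2) : ∑ i, formRelation H r i • H i = 0 := by
  -- If `p 0 = 0`, the remaining coordinates of `p` lie in the kernel of the invertible `topMinor
  -- H`.
  have hp0 : p 0 ≠ 0 := by
    intro h0
    have h1 : (fun k : Fin n => p k.succ) = 0 := by
      refine Matrix.eq_zero_of_mulVec_eq_zero hD (funext fun j => ?_)
      have := hH (Fin.castAdd 2 j)
      rw [dotProduct, Fin.sum_univ_succ, h0, mul_zero, zero_add] at this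
      exact this
    refine hp (funext fun k => ?_)
    exact Fin.cases h0 (fun k => congrFun h1 k) k
  set w := ∑ i, formRelation H r i • H i with hw
  have hws : ∀ k : Fin n, w k.succ = 0 := by
    intro k
    have h1 : (((fun k : Fin n => H (Fin.natAdd n r) k.succ) ᵥ* (topMinor H).adjugate) ᵥ*
        topMinor H) k = (topMinor H).det * H (Fin.natAdd n r) k.succ := by
      rw [Matrix.vecMul_vecMul, Matrix.adjugate_mul, Matrix.vecMul_smul, Matrix.vecMul_one]
      rfl
    rw [hw, sum_formRelation_smul, Pi.sub_apply, Finset.sum_apply, Pi.smul_apply, smul_eq_mul,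
      ← h1, sub_eq_zero]
    simp only [formRelation, Fin.addCases_left, Pi.smul_apply, smul_eq_mul]
    rfl
  have hwp : w ⬝ᵥ p = 0 := by
    simp [hw, sum_dotProduct, hH]
  rw [dotProduct, Fin.sum_univ_succ] at hwp
  simp only [hws, zero_mul, Finset.sum_const_zero, add_zero, mul_eq_zero, hp0, or_false] at hwp
  funext k
  exact Fin.cases hwp hws k

/-- Index set for the unknowns `τ`, `μ`. -/
abbrev UnknownIndex (n : ℕ) : Type := Fin (n + 2) ⊕ Fin (n + 2)

/-- The linear system for `τ`, `μ`: the relations between the forms `H i` extend to the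
forms `τ i H i + μ i G i`, normalized by the values of `τ (last)` and `μ 0`. -/
noncomputable def systemMatrix {n : ℕ} (H G : Fin (n + 2) → Fin (n + 1) → ℂ) :
    Matrix (UnknownIndex n) (UnknownIndex n) ℂ :=
  let eqn (r : Fin 2) (k : Fin (n + 1)) : UnknownIndex n → ℂ :=
    Sum.elim (fun i => formRelation H r i * H i k) (fun i => formRelation H r i * G i k)
  Sum.elim
    (fun l : Fin (n + 2) => Fin.cases (Pi.single (Sum.inl (Fin.last (n + 1))) 1) (eqn 0) l)
    (fun l : Fin (n + 2) => Fin.cases (Pi.single (Sum.inr 0) 1) (eqn 1) l)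

theorem systemMatrix_mulVec_eq_iff {n : ℕ} {H G : Fin (n + 2) → Fin (n + 1) → ℂ}
    {z : UnknownIndex n → ℂ} {c : ℂ} :
    systemMatrix H G *ᵥ z = Pi.single (Sum.inr 0) c ↔
      z (Sum.inl (Fin.last (n + 1))) = 0 ∧ z (Sum.inr 0) = c ∧
      ∀ r, ∑ i, formRelation H r i • (z (Sum.inl i) • H i + z (Sum.inr i) • G i) = 0 := by
  have h1 : (systemMatrix H G *ᵥ z) (Sum.inl 0) = z (Sum.inl (Fin.last (n + 1))) :=
    single_one_dotProduct _ _
  have h2 : (systemMatrix H G *ᵥ z) (Sum.inr 0) = z (Sum.inr 0) :=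
    single_one_dotProduct _ _
  have aux : ∀ (r : Fin 2) (k : Fin (n + 1)),
      (Sum.elim (fun i => formRelation H r i * H i k)
        (fun i => formRelation H r i * G i k) : UnknownIndex n → ℂ) ⬝ᵥ z =
      (∑ i, formRelation H r i • (z (Sum.inl i) • H i + z (Sum.inr i) • G i)) k := by
    intro r k
    simp only [dotProduct, Fintype.sum_sum_type, Sum.elim_inl, Sum.elim_inr, Finset.sum_apply,
      Pi.smul_apply, Pi.add_apply, smul_eq_mul, ← Finset.sum_add_distrib]
    refine Finset.sum_congr rfl fun i _ => ?_
    ring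
  have h3 : ∀ k : Fin (n + 1), (systemMatrix H G *ᵥ z) (Sum.inl k.succ) =
      (∑ i, formRelation H 0 i • (z (Sum.inl i) • H i + z (Sum.inr i) • G i)) k :=
    fun k => aux 0 k
  have h4 : ∀ k : Fin (n + 1), (systemMatrix H G *ᵥ z) (Sum.inr k.succ) =
      (∑ i, formRelation H 1 i • (z (Sum.inl i) • H i + z (Sum.inr i) • G i)) k :=
    fun k => aux 1 k
  constructor
  · intro h
    refine ⟨?_, ?_, fun r => funext fun k => ?_⟩
    · rw [← h1, h]; simp
    · rw [← h2, h]; simp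
    · fin_cases r
      · refine (h3 k).symm.trans ?_
        rw [h]; simp
      · refine (h4 k).symm.trans ?_
        rw [h]; simp
  · rintro ⟨ha, hb, hc⟩
    funext l
    rcases l with l | l
    · refine Fin.cases ?_ (fun k => ?_) l
      · rw [h1, ha]; simp
      · rw [h3, hc]; simp
    · refine Fin.cases ?_ (fun k => ?_) l
      · rw [h2, hb]; simp
      · rw [h4, hc]; simp

/-- The solution of the linear system for `τ`, `μ`, multiplied by its determinant. -/
noncomputable def systemSolution {n : ℕ} (H G : Fin (n + 2) → Fin (n + 1) → ℂ) :
    UnknownIndex n → ℂ :=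
  (systemMatrix H G).adjugate *ᵥ Pi.single (Sum.inr 0) 1

theorem systemMatrix_mulVec_systemSolution {n : ℕ} (H G : Fin (n + 2) → Fin (n + 1) → ℂ) :
    systemMatrix H G *ᵥ systemSolution H G =
      Pi.single (Sum.inr 0) (systemMatrix H G).det := by
  rw [systemSolution, Matrix.mulVec_mulVec, Matrix.mul_adjugate, Matrix.smul_mulVec,
    Matrix.one_mulVec, ← Pi.single_smul, smul_eq_mul, mul_one]

/-- Cramer's rule without division: the solutions are determined by their value `c = μ 0` once the
determinant is nonzero. -/
theorem det_smul_eq_smul_systemSolution {n : ℕ} {H G : Fin (n + 2) → Fin (n + 1) → ℂ}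
    {z : UnknownIndex n → ℂ} {c : ℂ}
    (h : systemMatrix H G *ᵥ z = Pi.single (Sum.inr 0) c) :
    (systemMatrix H G).det • z = c • systemSolution H G := by
  have h1 := congrArg (fun w => (systemMatrix H G).adjugate *ᵥ w) h
  simp only [Matrix.mulVec_mulVec, Matrix.adjugate_mul, Matrix.smul_mulVec,
    Matrix.one_mulVec] at h1
  rw [h1, systemSolution, ← Matrix.mulVec_smul, ← Pi.single_smul, smul_eq_mul, mul_one]

/-! ### Existence and uniqueness of the secant curve -/

/-- The parametrization of the secant curve attached to the linear forms `H i`, `G i`. -/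
noncomputable def secantCurve {n : ℕ} (H G : Fin (n + 2) → Fin (n + 1) → ℂ) :
    Fin (n + 1) → Polynomial ℂ :=
  pencilCurve (topRows H) (-topRows fun i =>
    systemSolution H G (Sum.inl i) • H i + systemSolution H G (Sum.inr i) • G i)

/-- The open conditions on a point `p` and linear forms `H i` (vanishing at `p`), `G i`, under
which the secant curve is unique. -/
structure IsGeneral {n : ℕ} (p : Fin (n + 1) → ℂ) (H G : Fin (n + 2) → Fin (n + 1) → ℂ) :
    Prop where
  base : ∀ i, G i ⬝ᵥ p ≠ 0
  minor : (topMinor H).det ≠ 0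
  system : (systemMatrix H G).det ≠ 0
  slope : ∀ i, systemSolution H G (Sum.inr i) ≠ 0
  coeffs : (coeffMatrix (secantCurve H G)).det ≠ 0
  roots : ∀ i, (polyDot (H i) (secantCurve H G)).resultant
    (polyDot (H i) (secantCurve H G)).derivative (n - 1) (n - 1 - 1) ≠ 0

/-- For the first `n` indices this is the kernel equation of the pencil. The linear system was
designed so that the two relations among the `Hᵢ` carry the identity over to the last two indices.
-/
theorem secantCurve_mul_eq {n : ℕ} {p : Fin (n + 1) → ℂ} {H G : Fin (n + 2) → Fin (n + 1) → ℂ}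
    (hp : p ≠ 0) (hH : ∀ i, H i ⬝ᵥ p = 0) (hD : (topMinor H).det ≠ 0) (i : Fin (n + 2)) :
    (Polynomial.X - Polynomial.C (systemSolution H G (Sum.inl i))) *
        polyDot (H i) (secantCurve H G) =
      Polynomial.C (systemSolution H G (Sum.inr i)) * polyDot (G i) (secantCurve H G) := by
  set φ := secantCurve H G with hφ
  set z := systemSolution H G with hz
  suffices h : Polynomial.X * polyDot (H i) φ -
      polyDot (z (Sum.inl i) • H i + z (Sum.inr i) • G i) φ = 0 by
    rw [polyDot_add, polyDot_smul, polyDot_smul] at h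
    linear_combination h
  have htop : ∀ j : Fin n, Polynomial.X * polyDot (H (Fin.castAdd 2 j)) φ -
      polyDot (z (Sum.inl (Fin.castAdd 2 j)) • H (Fin.castAdd 2 j) +
        z (Sum.inr (Fin.castAdd 2 j)) • G (Fin.castAdd 2 j)) φ = 0 := by
    intro j
    rw [sub_eq_add_neg, ← neg_one_mul, ← Polynomial.C_1, ← Polynomial.C_neg, ← polyDot_smul,
      neg_one_smul]
    exact row_pencilCurve _ _ j
  refine Fin.addCases htop (fun r => ?_) i
  have hsum : ∑ i, formRelation H r i • (Polynomial.X * polyDot (H i) φ -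
      polyDot (z (Sum.inl i) • H i + z (Sum.inr i) • G i) φ) = 0 := by
    have h1 := (systemMatrix_mulVec_eq_iff.1 (systemMatrix_mulVec_systemSolution H G)).2.2 r
    have h2 := sum_formRelation_eq_zero hp hH hD r
    have h1' := polyDot_zero φ
    have h2' := polyDot_zero φ
    rw [← h1, polyDot_sum] at h1'
    rw [← h2, polyDot_sum] at h2'
    simp only [polyDot_smul] at h1' h2'
    simp only [Polynomial.smul_eq_C_mul, mul_sub, Finset.sum_sub_distrib]
    rw [h1', sub_zero, ← mul_zero Polynomial.X, ← h2', Finset.mul_sum]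
    refine Finset.sum_congr rfl fun i _ => ?_
    ring
  rw [sum_formRelation_smul] at hsum
  simpa [htop, hD] using hsum

theorem existsUnique_of_isGeneral {n : ℕ} (hn : 1 ≤ n) {p : Fin (n + 1) → ℂ}
    {H G : Fin (n + 2) → Fin (n + 1) → ℂ} (hH : ∀ i, H i ⬝ᵥ p = 0) (hgen : IsGeneral p H G)
    {δ : Datum n (n + 2)} (hδ : δ.2.submodule = Submodule.span ℂ {p})
    (hΛ : ∀ i v, v ∈ (δ.1 i).1 ↔ H i ⬝ᵥ v = 0 ∧ G i ⬝ᵥ v = 0) :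
    ∃! C : Set (PSpace n), IsRationalNormalCurve n C ∧ δ.2 ∈ C ∧ ∀ i, IsSecant (δ.1 i) C := by
  have hp : p ≠ 0 := by
    rintro rfl
    exact hgen.base 0 (by simp)
  set Φ := secantCurve H G with hΦ
  set z := systemSolution H G with hz
  have hdeg : ∀ k, (Φ k).natDegree ≤ n := natDegree_pencilCurve_le _ _
  have hli : LinearIndependent ℂ Φ := (det_coeffMatrix_ne_zero_iff hdeg).1 hgen.coeffs
  have hlead : leadVec Φ = maximalMinors (topRows H) := leadVec_pencilCurve _ _
  have hmin : maximalMinors (topRows H) ≠ 0 := by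
    intro h0
    have := congrFun h0 0
    simp only [maximalMinors, Fin.val_zero, pow_zero, one_mul, Pi.zero_apply] at this
    exact hgen.minor this
  have hspan : Submodule.span ℂ {p} = Submodule.span ℂ {leadVec Φ} := by
    rw [hlead]
    exact span_eq_span_maximalMinors hmin hp fun j => hH _
  have hbase : ∀ v : Fin (n + 1) → ℂ, Submodule.span ℂ {p} = Submodule.span ℂ {v} →
      ∀ i, H i ⬝ᵥ v = 0 ∧ G i ⬝ᵥ v ≠ 0 := by
    intro v hv i
    have hpv : p ∈ Submodule.span ℂ {v} := hv ▸ Submodule.mem_span_singleton_self p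
    obtain ⟨c, rfl⟩ := Submodule.mem_span_singleton.1 hpv
    have hc : c ≠ 0 := by rintro rfl; simp at hp
    have h1 := hH i
    have h2 := hgen.base i
    rw [dotProduct_smul, smul_eq_mul] at h1 h2
    exact ⟨(mul_eq_zero.1 h1).resolve_left hc, right_ne_zero_of_mul h2⟩
  have hrel := fun i => secantCurve_mul_eq (G := G) hp hH hgen.minor i
  have hdg := fun i => natDegree_of_mul_eq hdeg (hbase _ hspan i).2 (hgen.slope i) (hrel i)
  have hH0 : ∀ i, H i ≠ 0 := by
    intro i h0
    exact (hdg i).2 (by rw [h0, polyDot_zero])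
  refine ⟨ratCurve (leadVec Φ) Φ, ⟨isRationalNormalCurve_ratCurve hdeg hli,
    Or.inl (hδ.trans hspan), fun i => ?_⟩, ?_⟩
  · exact isSecant_of_mul_eq hn hdeg hli (hΛ i) (hbase _ hspan i).2 (hgen.slope i) (hrel i)
      ((resultant_derivative_ne_zero_iff (hdg i).1 (hdg i).2).1 (hgen.roots i))
  · rintro C ⟨hC, hPC, hsec⟩
    obtain ⟨φ, hφd, hφ, hPφ, rfl⟩ := hC.exists_param hPC
    have hb := hbase _ (hδ.symm.trans hPφ)
    choose τ μ hμ hτμ using fun i =>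
      (hsec i).exists_mul_eq hn hφd hφ (hΛ i) (hb i).2 (hb i).1 (hH0 i)
    -- A relation among the `Hᵢ`, evaluated on `φ` and multiplied by `X`, becomes a relation among
    -- the `(τᵢHᵢ + μᵢGᵢ)(φ)`; independence of `φ` lifts it to the forms.
    have hform : ∀ r, ∑ i, formRelation H r i • (τ i • H i + μ i • G i) = 0 := by
      intro r
      rw [← polyDot_eq_zero_iff hφ, polyDot_sum]
      have h2 := congrArg (fun h => Polynomial.X * polyDot h φ)
        (sum_formRelation_eq_zero hp hH hgen.minor r)
      simp only [polyDot_sum, polyDot_zero, mul_zero, polyDot_smul, Finset.mul_sum] at h2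
      rw [← h2]
      refine Finset.sum_congr rfl fun i _ => ?_
      rw [polyDot_smul, polyDot_add, polyDot_smul, polyDot_smul]
      linear_combination (-Polynomial.C (formRelation H r i)) * hτμ i
    -- Translating the parameter by `β` achieves the normalization `τ (last) = 0`; the shift
    -- preserves the system because the `Hᵢ` themselves satisfy the relations.
    set β := τ (Fin.last (n + 1)) with hβ
    have hsys : systemMatrix H G *ᵥ (Sum.elim (fun i => τ i - β) μ) =
        Pi.single (Sum.inr 0) (μ 0) := by
      refine systemMatrix_mulVec_eq_iff.2 ⟨sub_self _, rfl, fun r => ?_⟩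
      have h2 := sum_formRelation_eq_zero hp hH hgen.minor r
      refine Eq.trans ?_ (sub_eq_zero.2 ((hform r).trans ((congrArg (β • ·) h2).trans
        (smul_zero β)).symm))
      rw [Finset.smul_sum, ← Finset.sum_sub_distrib]
      refine Finset.sum_congr rfl fun i _ => ?_
      simp only [Sum.elim_inl, Sum.elim_inr]
      module
    have hprop := det_smul_eq_smul_systemSolution hsys
    set ε := μ 0 / (systemMatrix H G).det with hε
    have hε0 : ε ≠ 0 := div_ne_zero (hμ 0) hgen.system
    have hτ : ∀ i, τ i = β + ε * z (Sum.inl i) := by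
      intro i
      have := congrFun hprop (Sum.inl i)
      simp only [Pi.smul_apply, Sum.elim_inl, smul_eq_mul] at this
      rw [hε, div_mul_eq_mul_div, ← this, mul_div_cancel_left₀ _ hgen.system]
      ring
    have hμ' : ∀ i, μ i = ε * z (Sum.inr i) := by
      intro i
      have := congrFun hprop (Sum.inr i)
      simp only [Pi.smul_apply, Sum.elim_inr, smul_eq_mul] at this
      rw [hε, div_mul_eq_mul_div, ← this, mul_div_cancel_left₀ _ hgen.system]
    -- After the substitution `t = β + εs`, the vector `φ(t)` is killed by the matrix whose minors
    -- define `Φ(s)`.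
    have hpt : ∀ s, Submodule.span ℂ {evalVec φ (β + ε * s)} = Submodule.span ℂ {evalVec Φ s} := by
      intro s
      have hne : evalVec Φ s ≠ 0 := evalVec_ne_zero hdeg hli s
      rw [hΦ, secantCurve, evalVec_pencilCurve] at hne ⊢
      refine span_eq_span_maximalMinors hne (evalVec_ne_zero hφd hφ _) fun j => ?_
      have h1 := congrArg (Polynomial.eval (β + ε * s)) (hτμ (Fin.castAdd 2 j))
      simp only [Polynomial.eval_mul, Polynomial.eval_sub, Polynomial.eval_X, Polynomial.eval_C,
        eval_polyDot, hτ (Fin.castAdd 2 j), hμ' (Fin.castAdd 2 j)] at h1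
      change (s • H (Fin.castAdd 2 j) + -(z (Sum.inl (Fin.castAdd 2 j)) • H (Fin.castAdd 2 j) +
        z (Sum.inr (Fin.castAdd 2 j)) • G (Fin.castAdd 2 j))) ⬝ᵥ _ = 0
      rw [add_dotProduct, neg_dotProduct, add_dotProduct, smul_dotProduct, smul_dotProduct,
        smul_dotProduct]
      simp only [smul_eq_mul]
      refine (mul_eq_zero.1 (?_ : ε * _ = 0)).resolve_left hε0
      linear_combination h1
    ext x
    simp only [ratCurve, Set.mem_ofPred_eq]
    rw [← hPφ, hδ, hspan]
    refine or_congr Iff.rfl ⟨?_, ?_⟩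
    · rintro ⟨t, ht⟩
      refine ⟨(t - β) / ε, ?_⟩
      rw [← hpt, mul_div_cancel₀ _ hε0, add_sub_cancel, ht]
    · rintro ⟨s, hs⟩
      exact ⟨β + ε * s, by rw [hpt, hs]⟩

/-! ### Rings of functions closed under determinants and resultants -/

section FunctionRings

variable {α K : Type*} [CommRing K] {ι : Type*}

theorem Subring.fun_sum_mem (S : Subring (α → K)) (s : Finset ι) {f : α → ι → K}
    (h : ∀ i ∈ s, (fun a => f a i) ∈ S) : (fun a => ∑ i ∈ s, f a i) ∈ S := by
  have := S.sum_mem h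
  rwa [Finset.sum_fn] at this

theorem Subring.fun_prod_mem (S : Subring (α → K)) (s : Finset ι) {f : α → ι → K}
    (h : ∀ i ∈ s, (fun a => f a i) ∈ S) : (fun a => ∏ i ∈ s, f a i) ∈ S := by
  have := S.prod_mem h
  rwa [Finset.prod_fn] at this

theorem Subring.fun_dotProduct_mem [Fintype ι] (S : Subring (α → K)) {g h : α → ι → K}
    (hg : ∀ k, (fun a => g a k) ∈ S) (hh : ∀ k, (fun a => h a k) ∈ S) :
    (fun a => g a ⬝ᵥ h a) ∈ S :=
  S.fun_sum_mem _ fun k _ => S.mul_mem (hg k) (hh k)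

theorem Subring.fun_ite_mem (S : Subring (α → K)) (p : Prop) [Decidable p] {f g : α → K}
    (hf : (fun a => f a) ∈ S) (hg : (fun a => g a) ∈ S) :
    (fun a => if p then f a else g a) ∈ S := by
  split_ifs <;> assumption

theorem Subring.fun_single_mem [DecidableEq ι] (S : Subring (α → K)) (i j : ι) :
    (fun _ => (Pi.single i 1 : ι → K) j) ∈ S := by
  by_cases h : j = i
  · subst h
    simp only [Pi.single_eq_same]
    exact S.one_mem
  · simp only [Pi.single_eq_of_ne h]
    exact S.zero_mem

theorem Subring.fun_det_mem [Fintype ι] [DecidableEq ι] (S : Subring (α → K))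
    {M : α → Matrix ι ι K} (h : ∀ i j, (fun a => M a i j) ∈ S) : (fun a => (M a).det) ∈ S := by
  simp only [Matrix.det_apply']
  refine S.fun_sum_mem _ fun σ _ => S.mul_mem (intCast_mem S _) ?_
  exact S.fun_prod_mem _ fun i _ => h _ _

theorem Subring.fun_adjugate_mem [Fintype ι] [DecidableEq ι] (S : Subring (α → K))
    {M : α → Matrix ι ι K} (h : ∀ i j, (fun a => M a i j) ∈ S) (i j : ι) :
    (fun a => (M a).adjugate i j) ∈ S := by
  simp only [Matrix.adjugate_apply]
  refine S.fun_det_mem fun k l => ?_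
  simp only [Matrix.updateRow_apply]
  exact S.fun_ite_mem _ (S.fun_single_mem _ _) (h _ _)

/-- The families of polynomials whose coefficients belong to a ring of functions. -/
def Subring.polynomialFamilies (S : Subring (α → K)) : Subring (α → Polynomial K) where
  carrier := {p | ∀ m, (fun a => (p a).coeff m) ∈ S}
  mul_mem' := by
    intro p q hp hq m
    simp only [Pi.mul_apply, Polynomial.coeff_mul]
    exact S.fun_sum_mem _ fun i _ => S.mul_mem (hp _) (hq _)
  one_mem' := by
    intro m
    simp only [Pi.one_apply, Polynomial.coeff_one]
    exact S.fun_ite_mem _ S.one_mem S.zero_mem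
  add_mem' := by
    intro p q hp hq m
    simp only [Pi.add_apply, Polynomial.coeff_add]
    exact S.add_mem (hp _) (hq _)
  zero_mem' := by
    intro m
    simp only [Pi.zero_apply, Polynomial.coeff_zero]
    exact S.zero_mem
  neg_mem' := by
    intro p hp m
    simp only [Pi.neg_apply, Polynomial.coeff_neg]
    exact S.neg_mem (hp _)

theorem Subring.fun_C_mem (S : Subring (α → K)) {f : α → K} (hf : (fun a => f a) ∈ S) :
    (fun a => Polynomial.C (f a)) ∈ S.polynomialFamilies := by
  intro m
  simp only [Polynomial.coeff_C]
  exact S.fun_ite_mem _ hf S.zero_mem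

theorem Subring.fun_X_mem (S : Subring (α → K)) :
    (fun _ => Polynomial.X) ∈ S.polynomialFamilies := by
  intro m
  simp only [Polynomial.coeff_X]
  exact S.fun_ite_mem _ S.one_mem S.zero_mem

theorem Subring.fun_derivative_mem (S : Subring (α → K)) {p : α → Polynomial K}
    (hp : (fun a => p a) ∈ S.polynomialFamilies) :
    (fun a => (p a).derivative) ∈ S.polynomialFamilies := by
  intro m
  simp only [Polynomial.coeff_derivative]
  exact S.mul_mem (hp _) (S.add_mem (natCast_mem S m) S.one_mem)

/-- The sizes `m` and `n` are fixed independently of the actual degrees, so the Sylvester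
determinant is one polynomial expression for the whole family. -/
theorem Subring.fun_resultant_mem (S : Subring (α → K)) {p q : α → Polynomial K}
    (hp : (fun a => p a) ∈ S.polynomialFamilies) (hq : (fun a => q a) ∈ S.polynomialFamilies)
    (m n : ℕ) : (fun a => (p a).resultant (q a) m n) ∈ S := by
  refine S.fun_det_mem fun i j => ?_
  simp only [Polynomial.sylvester, Matrix.of_apply]
  refine Fin.addCases (fun j => ?_) (fun j => ?_) j
  · simp only [Fin.addCases_left]
    exact S.fun_ite_mem _ (hq _) S.zero_mem
  · simp only [Fin.addCases_right]
    exact S.fun_ite_mem _ (hp _) S.zero_mem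

end FunctionRings

/-! ### General position as a polynomial condition -/

section GeneralPosition

variable {α : Type*} {n : ℕ} (S : Subring (α → ℂ))

theorem polyDot_mem {m : ℕ} {h : α → Fin m → ℂ} (hh : ∀ k, (fun a => h a k) ∈ S)
    {φ : α → Fin m → Polynomial ℂ} (hφ : ∀ k, (fun a => φ a k) ∈ S.polynomialFamilies) :
    (fun a => polyDot (h a) (φ a)) ∈ S.polynomialFamilies :=
  S.polynomialFamilies.fun_sum_mem _ fun k _ =>
    S.polynomialFamilies.mul_mem (S.fun_C_mem (hh k)) (hφ k)

theorem pencilCurve_mem {A B : α → Matrix (Fin n) (Fin (n + 1)) ℂ}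
    (hA : ∀ i j, (fun a => A a i j) ∈ S) (hB : ∀ i j, (fun a => B a i j) ∈ S) (k : Fin (n + 1)) :
    (fun a => pencilCurve (A a) (B a) k) ∈ S.polynomialFamilies := by
  refine S.polynomialFamilies.mul_mem (S.polynomialFamilies.pow_mem
    (S.polynomialFamilies.neg_mem S.polynomialFamilies.one_mem) _) ?_
  refine S.polynomialFamilies.fun_det_mem fun i j => ?_
  exact S.polynomialFamilies.add_mem
    (S.polynomialFamilies.mul_mem S.fun_X_mem (S.fun_C_mem (hA _ _))) (S.fun_C_mem (hB _ _))

theorem det_coeffMatrix_mem {φ : α → Fin (n + 1) → Polynomial ℂ}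
    (hφ : ∀ k, (fun a => φ a k) ∈ S.polynomialFamilies) :
    (fun a => (coeffMatrix (φ a)).det) ∈ S :=
  S.fun_det_mem fun m k => hφ k m

variable {p : α → Fin (n + 1) → ℂ} {H G : α → Fin (n + 2) → Fin (n + 1) → ℂ}

theorem formRelation_mem (hH : ∀ i k, (fun a => H a i k) ∈ S) (r : Fin 2) (i : Fin (n + 2)) :
    (fun a => formRelation (H a) r i) ∈ S := by
  refine Fin.addCases (fun j => ?_) (fun s => ?_) i
  · simp only [formRelation, Fin.addCases_left]
    exact S.fun_dotProduct_mem (fun k => hH _ _) fun k =>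
      S.fun_adjugate_mem (fun i j => hH _ _) k j
  · simp only [formRelation, Fin.addCases_right]
    exact S.fun_ite_mem _ (S.neg_mem (S.fun_det_mem fun i j => hH _ _)) S.zero_mem

theorem systemMatrix_mem (hH : ∀ i k, (fun a => H a i k) ∈ S)
    (hG : ∀ i k, (fun a => G a i k) ∈ S) (l m : UnknownIndex n) :
    (fun a => systemMatrix (H a) (G a) l m) ∈ S := by
  have key : ∀ r k, (fun a => (Sum.elim (fun i => formRelation (H a) r i * H a i k)
      (fun i => formRelation (H a) r i * G a i k) : UnknownIndex n → ℂ) m) ∈ S := by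
    intro r k
    rcases m with m | m
    · exact S.mul_mem (formRelation_mem S hH r m) (hH m k)
    · exact S.mul_mem (formRelation_mem S hH r m) (hG m k)
  rcases l with l | l
  · refine Fin.cases ?_ (fun k => key 0 k) l
    exact S.fun_single_mem _ m
  · refine Fin.cases ?_ (fun k => key 1 k) l
    exact S.fun_single_mem _ m

theorem systemSolution_mem (hH : ∀ i k, (fun a => H a i k) ∈ S)
    (hG : ∀ i k, (fun a => G a i k) ∈ S) (l : UnknownIndex n) :
    (fun a => systemSolution (H a) (G a) l) ∈ S :=
  S.fun_dotProduct_mem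
    (fun m => S.fun_adjugate_mem (fun i j => systemMatrix_mem S hH hG i j) l m)
    fun m => S.fun_single_mem _ m

theorem secantCurve_mem (hH : ∀ i k, (fun a => H a i k) ∈ S)
    (hG : ∀ i k, (fun a => G a i k) ∈ S) (k : Fin (n + 1)) :
    (fun a => secantCurve (H a) (G a) k) ∈ S.polynomialFamilies :=
  pencilCurve_mem S (fun _ _ => hH _ _) (fun _ _ => S.neg_mem (S.add_mem
    (S.mul_mem (systemSolution_mem S hH hG _) (hH _ _))
    (S.mul_mem (systemSolution_mem S hH hG _) (hG _ _)))) k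

/-- General position is the nonvanishing of one function in any ring of functions containing the
coordinates. -/
theorem exists_ne_zero_iff_isGeneral (hp : ∀ k, (fun a => p a k) ∈ S)
    (hH : ∀ i k, (fun a => H a i k) ∈ S) (hG : ∀ i k, (fun a => G a i k) ∈ S) :
    ∃ q ∈ S, ∀ a, q a ≠ 0 ↔ IsGeneral (p a) (H a) (G a) := by
  have hΦ := secantCurve_mem S hH hG
  refine ⟨fun a => (∏ i, G a i ⬝ᵥ p a) * (topMinor (H a)).det *
    (systemMatrix (H a) (G a)).det * (∏ i, systemSolution (H a) (G a) (Sum.inr i)) *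
    (coeffMatrix (secantCurve (H a) (G a))).det *
    ∏ i, (polyDot (H a i) (secantCurve (H a) (G a))).resultant
      (polyDot (H a i) (secantCurve (H a) (G a))).derivative (n - 1) (n - 1 - 1), ?_, fun a => ?_⟩
  · refine S.mul_mem (S.mul_mem (S.mul_mem (S.mul_mem (S.mul_mem ?_ ?_) ?_) ?_) ?_) ?_
    · exact S.fun_prod_mem _ fun i _ => S.fun_dotProduct_mem (hG i) hp
    · exact S.fun_det_mem fun _ _ => hH _ _
    · exact S.fun_det_mem (systemMatrix_mem S hH hG)
    · exact S.fun_prod_mem _ fun i _ => systemSolution_mem S hH hG _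
    · exact det_coeffMatrix_mem S hΦ
    · exact S.fun_prod_mem _ fun i _ => S.fun_resultant_mem (polyDot_mem S (hH i) hΦ)
        (S.fun_derivative_mem (polyDot_mem S (hH i) hΦ)) _ _
  · simp only [mul_ne_zero_iff, Finset.prod_ne_zero_iff, Finset.mem_univ, true_imp_iff]
    exact ⟨fun ⟨⟨⟨⟨⟨h1, h2⟩, h3⟩, h4⟩, h5⟩, h6⟩ => ⟨h1, h2, h3, h4, h5, h6⟩,
      fun ⟨h1, h2, h3, h4, h5, h6⟩ => ⟨⟨⟨⟨⟨h1, h2⟩, h3⟩, h4⟩, h5⟩, h6⟩⟩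

end GeneralPosition

/-! ### Changes of frame -/

/-- The action of scalars on the point, and of `2 × 2` matrices on the pairs of linear forms. -/
noncomputable def frameChange {n l : ℕ} (c : ℂ) (g : Fin l → Matrix (Fin 2) (Fin 2) ℂ)
    (x : FrameIndex n l → ℂ) : FrameIndex n l → ℂ :=
  Sum.elim (c • framePoint x) (fun a => (g a.1 * frameForms x a.1) a.2.1 a.2.2)

theorem frameForms_frameChange {n l : ℕ} (c : ℂ) (g : Fin l → Matrix (Fin 2) (Fin 2) ℂ)
    (x : FrameIndex n l → ℂ) (i : Fin l) :
    frameForms (frameChange c g x) i = g i * frameForms x i := rfl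

theorem ext_frame {n l : ℕ} {x y : FrameIndex n l → ℂ} (h : framePoint x = framePoint y)
    (h' : ∀ i, frameForms x i = frameForms y i) : x = y := by
  funext a
  rcases a with j | ⟨i, k, j⟩
  · exact congrFun h j
  · exact congrFun (congrFun (h' i) k) j

/-- A linear form vanishing on the common kernel of the rows of `M` is a combination of these rows.
-/
theorem exists_mul_eq_of_ker_le {n : ℕ} {M N : Matrix (Fin 2) (Fin (n + 1)) ℂ}
    (h : LinearMap.ker M.mulVecLin ≤ LinearMap.ker N.mulVecLin) :
    ∃ g : Matrix (Fin 2) (Fin 2) ℂ, N = g * M := by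
  have key : ∀ k, ∃ c : Fin 2 → ℂ, N k = c ᵥ* M := by
    intro k
    let L : (Fin (n + 1) → ℂ) → (Fin (n + 1) → ℂ) →ₗ[ℂ] ℂ := fun r => dotProductBilin ℂ ℂ r
    have hmem : L (N k) ∈ Submodule.span ℂ (Set.range fun j => L (M j)) := by
      refine mem_span_of_iInf_ker_le_ker fun v hv => ?_
      have hv' : v ∈ LinearMap.ker M.mulVecLin := by
        rw [LinearMap.mem_ker, Matrix.mulVecLin_apply]
        funext j
        exact LinearMap.mem_ker.1 ((Submodule.mem_iInf _).1 hv j)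
      exact congrFun (LinearMap.mem_ker.1 (h hv')) k
    obtain ⟨c, hc⟩ := (Submodule.mem_span_range_iff_exists_fun ℂ).1 hmem
    refine ⟨c, funext fun j => ?_⟩
    have := LinearMap.congr_fun hc (Pi.single j 1)
    simp only [LinearMap.sum_apply, LinearMap.smul_apply] at this
    have e : ∀ r : Fin (n + 1) → ℂ, L r (Pi.single j 1) = r j := fun r => dotProduct_single_one r j
    simp only [e, smul_eq_mul] at this
    exact this.symm
  choose g hg using key
  exact ⟨g, funext hg⟩

theorem isUnit_det_of_mul_row_linearIndependent {n : ℕ} {g : Matrix (Fin 2) (Fin 2) ℂ}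
    {M : Matrix (Fin 2) (Fin (n + 1)) ℂ} (h : LinearIndependent ℂ (g * M).row) :
    IsUnit g.det := by
  rw [isUnit_iff_ne_zero]
  intro h0
  obtain ⟨u, hu, hu0⟩ := Matrix.exists_vecMul_eq_zero_iff.2 h0
  refine hu (funext (Fintype.linearIndependent_iff.1 h u ?_))
  have : u ᵥ* (g * M) = 0 := by rw [← Matrix.vecMul_vecMul, hu0, Matrix.zero_vecMul]
  rw [Matrix.vecMul_eq_sum] at this
  exact this

theorem row_linearIndependent_mul {n : ℕ} {g : Matrix (Fin 2) (Fin 2) ℂ} (hg : IsUnit g.det)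
    {M : Matrix (Fin 2) (Fin (n + 1)) ℂ} (h : LinearIndependent ℂ M.row) :
    LinearIndependent ℂ (g * M).row := by
  rw [← Matrix.vecMul_injective_iff] at h ⊢
  intro u v huv
  simp only [← Matrix.vecMul_vecMul] at huv
  exact Matrix.vecMul_injective_of_isUnit ((Matrix.isUnit_iff_isUnit_det g).2 hg) (h huv)

theorem ker_mulVecLin_mul {n : ℕ} {g : Matrix (Fin 2) (Fin 2) ℂ} (hg : IsUnit g.det)
    (M : Matrix (Fin 2) (Fin (n + 1)) ℂ) :
    LinearMap.ker (g * M).mulVecLin = LinearMap.ker M.mulVecLin := by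
  ext v
  simp only [LinearMap.mem_ker, Matrix.mulVecLin_apply, ← Matrix.mulVec_mulVec]
  exact ⟨Matrix.eq_zero_of_mulVec_eq_zero hg.ne_zero, fun h => by rw [h, Matrix.mulVec_zero]⟩

theorem Frame.exists_eq_frameChange {n l : ℕ} {x y : Frame n l} (h : x.toDatum = y.toDatum) :
    ∃ (c : ℂ) (g : Fin l → Matrix (Fin 2) (Fin 2) ℂ), c ≠ 0 ∧ (∀ i, IsUnit (g i).det) ∧
      x.1 = frameChange c g y.1 := by
  obtain ⟨c, hc⟩ := (Projectivization.mk_eq_mk_iff ℂ _ _ x.2.1 y.2.1).1 (congrArg Prod.snd h)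
  have hker : ∀ i, LinearMap.ker (frameForms x.1 i).mulVecLin =
      LinearMap.ker (frameForms y.1 i).mulVecLin := fun i =>
    congrArg Subtype.val (congrFun (congrArg Prod.fst h) i)
  choose g hg using fun i => exists_mul_eq_of_ker_le (hker i).ge
  refine ⟨c, g, c.ne_zero, fun i => ?_, ext_frame hc.symm hg⟩
  refine isUnit_det_of_mul_row_linearIndependent (M := frameForms y.1 i) ?_
  rw [← hg i]
  exact x.2.2 i

/-- The frame obtained by changing the coordinates of the point and the pairs of forms. -/
noncomputable def Frame.change {n l : ℕ} (x : Frame n l) (c : ℂ)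
    (g : Fin l → Matrix (Fin 2) (Fin 2) ℂ) (hc : c ≠ 0) (hg : ∀ i, IsUnit (g i).det) :
    Frame n l :=
  ⟨frameChange c g x.1, smul_ne_zero hc x.2.1, fun i => by
    rw [frameForms_frameChange]
    exact row_linearIndependent_mul (hg i) (x.2.2 i)⟩

theorem Frame.toDatum_change {n l : ℕ} (x : Frame n l) {c : ℂ}
    {g : Fin l → Matrix (Fin 2) (Fin 2) ℂ} (hc : c ≠ 0) (hg : ∀ i, IsUnit (g i).det) :
    (x.change c g hc hg).toDatum = x.toDatum := by
  refine Prod.ext (funext fun i => Subtype.ext ?_) ?_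
  · change LinearMap.ker (frameForms (frameChange c g x.1) i).mulVecLin =
      LinearMap.ker (frameForms x.1 i).mulVecLin
    rw [frameForms_frameChange, ker_mulVecLin_mul (hg i)]
  · exact (Projectivization.mk_eq_mk_iff ℂ _ _ _ _).2 ⟨Units.mk0 c hc, rfl⟩

/-! ### Regular functions and open sets of data -/

/-- The ring of polynomial functions on an affine space. -/
noncomputable def regularFunctions (σ : Type) : Subring ((σ → ℂ) → ℂ) :=
  (RingHom.pi fun x : σ → ℂ => MvPolynomial.eval x).range

theorem mem_regularFunctions {σ : Type} {f : (σ → ℂ) → ℂ} :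
    f ∈ regularFunctions σ ↔ ∃ q : MvPolynomial σ ℂ, ∀ x, MvPolynomial.eval x q = f x :=
  ⟨fun ⟨q, hq⟩ => ⟨q, fun x => congrFun hq x⟩, fun ⟨q, hq⟩ => ⟨q, funext hq⟩⟩

theorem coord_mem_regularFunctions {σ : Type} (a : σ) :
    (fun x => x a) ∈ regularFunctions σ :=
  mem_regularFunctions.2 ⟨MvPolynomial.X a, fun _ => MvPolynomial.eval_X a⟩

theorem const_mem_regularFunctions {σ : Type} (c : ℂ) :
    (fun _ => c) ∈ regularFunctions σ :=
  mem_regularFunctions.2 ⟨MvPolynomial.C c, fun _ => MvPolynomial.eval_C c⟩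

theorem comp_mem_regularFunctions {σ τ : Type} {f : (σ → ℂ) → ℂ}
    (hf : f ∈ regularFunctions σ) {θ : (τ → ℂ) → σ → ℂ}
    (hθ : ∀ a, (fun y => θ y a) ∈ regularFunctions τ) :
    (fun y => f (θ y)) ∈ regularFunctions τ := by
  obtain ⟨q, hq⟩ := mem_regularFunctions.1 hf
  choose s hs using fun a => mem_regularFunctions.1 (hθ a)
  refine mem_regularFunctions.2 ⟨MvPolynomial.bind₁ s q, fun y => ?_⟩
  rw [MvPolynomial.eval, MvPolynomial.eval₂Hom_bind₁, ← hq]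
  congr 2
  funext a
  exact hs a y

theorem frameChange_mem_regularFunctions {n l : ℕ} (c : ℂ)
    (g : Fin l → Matrix (Fin 2) (Fin 2) ℂ) (a : FrameIndex n l) :
    (fun x => frameChange c g x a) ∈ regularFunctions (FrameIndex n l) := by
  rcases a with j | ⟨i, k, j⟩
  · exact Subring.mul_mem _ (const_mem_regularFunctions c) (coord_mem_regularFunctions _)
  · exact Subring.fun_dotProduct_mem _ (fun m => const_mem_regularFunctions (g i k m))
      fun m => coord_mem_regularFunctions (Sum.inr (i, m, j))

/-- Two frames of one datum differ by a change of frame, so the preimage in the space of frames is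
the union of the translates of the locus `f ≠ 0`. Each translate is open since the action is
polynomial. -/
theorem isOpen_setOf_exists_frame {n l : ℕ} {f : (FrameIndex n l → ℂ) → ℂ}
    (hf : f ∈ regularFunctions (FrameIndex n l)) :
    IsOpen[zariskiDatum n l] {δ | ∃ x : Frame n l, f x.1 ≠ 0 ∧ x.toDatum = δ} := by
  rw [isOpen_coinduced]
  let : TopologicalSpace (FrameIndex n l → ℂ) := zariskiAffine (FrameIndex n l)
  let : TopologicalSpace (Frame n l) := TopologicalSpace.induced Subtype.val inferInstance
  rw [isOpen_iff_forall_mem_open]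
  rintro y ⟨x, hfx, hxy⟩
  obtain ⟨c, g, hc, hg, hx⟩ := Frame.exists_eq_frameChange hxy
  obtain ⟨q, hq⟩ := mem_regularFunctions.1
    (comp_mem_regularFunctions hf (frameChange_mem_regularFunctions c g))
  refine ⟨{z | f (frameChange c g z.1) ≠ 0}, fun z hz => ?_, ?_, ?_⟩
  · exact ⟨z.change c g hc hg, hz, z.toDatum_change hc hg⟩
  · refine isOpen_induced_iff.2 ⟨{z | MvPolynomial.eval z q ≠ 0},
      TopologicalSpace.isOpen_generateFrom_of_mem ⟨q, rfl⟩, ?_⟩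
    ext z
    exact not_congr (by rw [hq])
  · simpa [← hx] using hfx

/-! ### Frames and the forms `H`, `G` -/

/-- The second linear forms of a frame. -/
def frameG {n l : ℕ} (x : FrameIndex n l → ℂ) (i : Fin l) : Fin (n + 1) → ℂ := frameForms x i 1

/-- The combinations of the linear forms of a frame vanishing at its point. -/
noncomputable def frameH {n l : ℕ} (x : FrameIndex n l → ℂ) (i : Fin l) : Fin (n + 1) → ℂ :=
  (frameG x i ⬝ᵥ framePoint x) • frameForms x i 0 -
    (frameForms x i 0 ⬝ᵥ framePoint x) • frameG x i

theorem frameH_dotProduct_framePoint {n l : ℕ} (x : FrameIndex n l → ℂ) (i : Fin l) :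
    frameH x i ⬝ᵥ framePoint x = 0 := by
  rw [frameH, sub_dotProduct, smul_dotProduct, smul_dotProduct, smul_eq_mul, smul_eq_mul]
  ring

theorem mem_toDatum_iff {n l : ℕ} (x : Frame n l) (i : Fin l)
    (hG : frameG x.1 i ⬝ᵥ framePoint x.1 ≠ 0) (v : Fin (n + 1) → ℂ) :
    v ∈ (x.toDatum.1 i).1 ↔ frameH x.1 i ⬝ᵥ v = 0 ∧ frameG x.1 i ⬝ᵥ v = 0 := by
  have h1 : v ∈ (x.toDatum.1 i).1 ↔ frameForms x.1 i 0 ⬝ᵥ v = 0 ∧ frameG x.1 i ⬝ᵥ v = 0 := by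
    change v ∈ LinearMap.ker (frameForms x.1 i).mulVecLin ↔ _
    rw [LinearMap.mem_ker, Matrix.mulVecLin_apply, funext_iff, Fin.forall_fin_two]
    rfl
  rw [h1]
  refine and_congr_left fun h => ?_
  rw [frameH, sub_dotProduct, smul_dotProduct, smul_dotProduct, h, smul_zero, sub_zero,
    smul_eq_mul, mul_eq_zero, or_iff_right hG]

theorem exists_ne_zero_iff_isGeneral_frame (n : ℕ) :
    ∃ f ∈ regularFunctions (FrameIndex n (n + 2)),
      ∀ x, f x ≠ 0 ↔ IsGeneral (framePoint x) (frameH x) (frameG x) := by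
  have hp : ∀ k, (fun x : FrameIndex n (n + 2) → ℂ => framePoint x k) ∈ regularFunctions _ :=
    fun k => coord_mem_regularFunctions _
  have hF : ∀ i j k, (fun x : FrameIndex n (n + 2) → ℂ => frameForms x i j k) ∈
      regularFunctions _ := fun i j k => coord_mem_regularFunctions (Sum.inr (i, j, k))
  refine exists_ne_zero_iff_isGeneral (regularFunctions (FrameIndex n (n + 2))) hp
    (fun i k => ?_) (fun i k => hF i 1 k)
  exact Subring.sub_mem _
    (Subring.mul_mem _ (Subring.fun_dotProduct_mem _ (hF i 1) hp) (hF i 0 k))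
    (Subring.mul_mem _ (Subring.fun_dotProduct_mem _ (hF i 0) hp) (hF i 1 k))

theorem IsGeneral.exists_frame {n : ℕ} (hn : 2 ≤ n) {p : Fin (n + 1) → ℂ}
    {H G : Fin (n + 2) → Fin (n + 1) → ℂ} (hH : ∀ i, H i ⬝ᵥ p = 0) (hgen : IsGeneral p H G) :
    ∃ x : Frame n (n + 2), framePoint x.1 = p ∧ frameH x.1 = H ∧ frameG x.1 = G := by
  have hp : p ≠ 0 := by
    rintro rfl
    exact hgen.base 0 (by simp)
  have hH0 : ∀ i, H i ≠ 0 := by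
    intro i h0
    have := hgen.roots i
    rw [h0, polyDot_zero, Polynomial.derivative_zero, Polynomial.resultant_zero_zero] at this
    -- The exponent is `(n - 1) + (n - 1 - 1)`, which is positive because `n ≥ 2`.
    exact this (zero_pow (by omega))
  -- The inverse factor cancels the factor `G i ⬝ᵥ p` by which `frameH` multiplies the first form;
  -- the other term of `frameH` vanishes with `H i ⬝ᵥ p`.
  let x : FrameIndex n (n + 2) → ℂ := Sum.elim p
    fun a => (![(G a.1 ⬝ᵥ p)⁻¹ • H a.1, G a.1] : Fin 2 → Fin (n + 1) → ℂ) a.2.1 a.2.2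
  refine ⟨⟨x, hp, fun i => ?_⟩, rfl, funext fun i => ?_, rfl⟩
  · refine Fintype.linearIndependent_iff.2 fun c hc => ?_
    rw [Fin.sum_univ_two] at hc
    change c 0 • (G i ⬝ᵥ p)⁻¹ • H i + c 1 • G i = 0 at hc
    have h1 := congrArg (· ⬝ᵥ p) hc
    simp only [add_dotProduct, smul_dotProduct, hH i, zero_dotProduct, smul_eq_mul,
      mul_zero, zero_add, mul_eq_zero, hgen.base i, or_false] at h1
    rw [h1, zero_smul, add_zero, smul_smul, smul_eq_zero, or_iff_left (hH0 i), mul_eq_zero,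
      or_iff_left (inv_ne_zero (hgen.base i))] at hc
    exact Fin.forall_fin_two.2 ⟨hc, h1⟩
  · change (G i ⬝ᵥ p) • (G i ⬝ᵥ p)⁻¹ • H i - (((G i ⬝ᵥ p)⁻¹ • H i) ⬝ᵥ p) • G i = H i
    rw [smul_dotProduct, hH i, smul_zero, zero_smul, sub_zero, smul_smul,
      mul_inv_cancel₀ (hgen.base i), one_smul]

/-! ### Data with a prescribed solution of the system -/

section NormalForm

variable {n : ℕ}

/-- The rows of `T`, together with the two linear combinations of them with coefficients `a r`. -/
def extendRows (a : Fin 2 → Fin n → ℂ) (T : Matrix (Fin n) (Fin (n + 1)) ℂ) :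
    Fin (n + 2) → Fin (n + 1) → ℂ :=
  Fin.addCases (fun j => T j) (fun r => a r ᵥ* T)

theorem extendRows_castAdd (a : Fin 2 → Fin n → ℂ) (T : Matrix (Fin n) (Fin (n + 1)) ℂ)
    (j : Fin n) : extendRows a T (Fin.castAdd 2 j) = T j := by
  simp [extendRows]

theorem extendRows_natAdd (a : Fin 2 → Fin n → ℂ) (T : Matrix (Fin n) (Fin (n + 1)) ℂ)
    (r : Fin 2) : extendRows a T (Fin.natAdd n r) = ∑ j, a r j • T j := by
  simp only [extendRows, Fin.addCases_right, Matrix.vecMul_eq_sum]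

/-- The coordinate forms other than the first one. -/
def coordRows (n : ℕ) : Matrix (Fin n) (Fin (n + 1)) ℂ := fun j => Pi.single j.succ 1

theorem topRows_extendRows (a : Fin 2 → Fin n → ℂ) (T : Matrix (Fin n) (Fin (n + 1)) ℂ) :
    topRows (extendRows a T) = T :=
  funext fun j => extendRows_castAdd a T j

theorem coordRows_succ (j k : Fin n) :
    coordRows n j k.succ = (1 : Matrix (Fin n) (Fin n) ℂ) j k := by
  simp [coordRows, Matrix.one_apply, Pi.single_apply, eq_comm]

theorem coordRows_zero (j : Fin n) : coordRows n j 0 = 0 := by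
  simp [coordRows, (Fin.succ_ne_zero j).symm]

theorem topMinor_extendRows (a : Fin 2 → Fin n → ℂ) :
    topMinor (extendRows a (coordRows n)) = 1 := by
  ext j k
  rw [topMinor, extendRows_castAdd, coordRows_succ]

theorem formRelation_extendRows (a : Fin 2 → Fin n → ℂ) (r : Fin 2) (j : Fin n) :
    formRelation (extendRows a (coordRows n)) r (Fin.castAdd 2 j) = a r j := by
  simp only [formRelation, Fin.addCases_left, topMinor_extendRows, Matrix.adjugate_one,
    Matrix.vecMul_one, extendRows_natAdd]
  simp [coordRows_succ, Matrix.one_apply]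

theorem sum_formRelation_extendRows {M : Type*} [AddCommGroup M] [Module ℂ M]
    (a : Fin 2 → Fin n → ℂ) (r : Fin 2) (w : Fin (n + 2) → M) :
    ∑ i, formRelation (extendRows a (coordRows n)) r i • w i =
      ∑ j : Fin n, a r j • w (Fin.castAdd 2 j) - w (Fin.natAdd n r) := by
  simp only [sum_formRelation_smul, formRelation_extendRows, topMinor_extendRows, Matrix.det_one,
    one_smul]

theorem maximalMinors_coordRows : maximalMinors (coordRows n) = Pi.single 0 1 := by
  funext k
  refine Fin.cases ?_ (fun j => ?_) k
  · have : (coordRows n).submatrix id (Fin.succAbove 0) = 1 := by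
      ext j k
      rw [Matrix.submatrix_apply, Fin.succAbove_zero, coordRows_succ, id]
    rw [maximalMinors, this]
    simp
  · have := row_dotProduct_maximalMinors (coordRows n) j
    rw [coordRows, single_one_dotProduct] at this
    rw [this, Pi.single_eq_of_ne (Fin.succ_ne_zero j)]

theorem extendRows_coordRows_dotProduct (a : Fin 2 → Fin n → ℂ) (i : Fin (n + 2)) :
    extendRows a (coordRows n) i ⬝ᵥ Pi.single 0 1 = 0 := by
  rw [dotProduct_single_one]
  refine Fin.addCases (fun j => ?_) (fun r => ?_) i
  · rw [extendRows_castAdd, coordRows_zero]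
  · simp [extendRows_natAdd, coordRows_zero]

/-- The forms `H` and `G` satisfy the same relations, so `τ = 0`, `μ = 1` solves the system;
`systemSolution` is this solution times the determinant. -/
theorem systemSolution_extendRows (a : Fin 2 → Fin n → ℂ) (B : Matrix (Fin n) (Fin (n + 1)) ℂ) :
    systemSolution (extendRows a (coordRows n)) (extendRows a B) = Sum.elim (fun _ => 0)
      fun _ => (systemMatrix (extendRows a (coordRows n)) (extendRows a B)).det := by
  have h : systemMatrix (extendRows a (coordRows n)) (extendRows a B) *ᵥ
      (Sum.elim (fun _ => 0) fun _ => 1) = Pi.single (Sum.inr 0) 1 := by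
    refine systemMatrix_mulVec_eq_iff.2 ⟨rfl, rfl, fun r => ?_⟩
    rw [sum_formRelation_extendRows]
    simp [extendRows_castAdd, extendRows_natAdd]
  have h1 := det_smul_eq_smul_systemSolution h
  rw [one_smul] at h1
  rw [← h1]
  funext l
  rcases l with l | l <;> simp

/-- With `τ = 0` and all `μ` equal to `δ`, the pencil at the parameter `δt` is `δ` times the pencil
with members `coordRows n` and `-B` at `t`, and its minors scale by `δⁿ`. -/
theorem comp_secantCurve_extendRows (a : Fin 2 → Fin n → ℂ)
    (B : Matrix (Fin n) (Fin (n + 1)) ℂ) (h : Fin (n + 1) → ℂ) {δ : ℂ}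
    (hδ : δ = (systemMatrix (extendRows a (coordRows n)) (extendRows a B)).det) :
    (polyDot h (secantCurve (extendRows a (coordRows n)) (extendRows a B))).comp
        (Polynomial.C δ * Polynomial.X) =
      Polynomial.C (δ ^ n) * polyDot h (pencilCurve (coordRows n) (-B)) := by
  refine Polynomial.funext fun t => ?_
  simp only [Polynomial.eval_comp, Polynomial.eval_mul, Polynomial.eval_C, Polynomial.eval_X,
    eval_polyDot]
  have e : (-topRows fun i =>
      systemSolution (extendRows a (coordRows n)) (extendRows a B) (Sum.inl i) •
        extendRows a (coordRows n) i +
      systemSolution (extendRows a (coordRows n)) (extendRows a B) (Sum.inr i) •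
        extendRows a B i) = -(δ • B) := by
    rw [systemSolution_extendRows, ← hδ]
    congr 1
    funext j
    simp only [topRows, extendRows_castAdd, Sum.elim_inl, Sum.elim_inr, zero_smul, zero_add]
    rfl
  rw [secantCurve, e, topRows_extendRows, evalVec_pencilCurve, evalVec_pencilCurve,
    ← smul_eq_mul (δ ^ n), ← dotProduct_smul, ← maximalMinors_smul, smul_add, smul_neg, mul_smul]

theorem separable_of_comp {f g : Polynomial ℂ} {δ c : ℂ} (hδ : δ ≠ 0) (hc : c ≠ 0)
    (h : f.comp (Polynomial.C δ * Polynomial.X) = Polynomial.C c * g) (hg : g.Separable) :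
    f.Separable := by
  unfold Polynomial.Separable at hg ⊢
  rw [Polynomial.isCoprime_iff_aeval_ne_zero_of_isAlgClosed ℂ ℂ] at hg ⊢
  intro r
  have h1 := congrArg (Polynomial.eval (r / δ)) h
  have h2 := congrArg (fun q => Polynomial.eval (r / δ) q.derivative) h
  simp only [Polynomial.eval_comp, Polynomial.eval_mul, Polynomial.eval_C, Polynomial.eval_X,
    mul_div_cancel₀ _ hδ] at h1
  simp only [Polynomial.derivative_comp, Polynomial.derivative_C_mul, Polynomial.derivative_X,
    Polynomial.eval_comp, Polynomial.eval_mul, Polynomial.eval_C, Polynomial.eval_X, mul_one,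
    mul_div_cancel₀ _ hδ] at h2
  simp only [Polynomial.coe_aeval_eq_eval] at hg ⊢
  refine (hg (r / δ)).imp (fun h0 h3 => h0 ?_) (fun h0 h3 => h0 ?_)
  · rw [h3] at h1
    exact (mul_eq_zero.1 h1.symm).resolve_left hc
  · rw [h3, mul_zero] at h2
    exact (mul_eq_zero.1 h2.symm).resolve_left hc

theorem X_mul_polyDot_extendRows (a : Fin 2 → Fin n → ℂ) (B : Matrix (Fin n) (Fin (n + 1)) ℂ)
    (i : Fin (n + 2)) :
    Polynomial.X * polyDot (extendRows a (coordRows n) i) (pencilCurve (coordRows n) (-B)) =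
      polyDot (extendRows a B i) (pencilCurve (coordRows n) (-B)) := by
  have key : ∀ j, Polynomial.X * polyDot (coordRows n j) (pencilCurve (coordRows n) (-B)) =
      polyDot (B j) (pencilCurve (coordRows n) (-B)) := by
    intro j
    have h1 := row_pencilCurve (coordRows n) (-B) j
    have h2 : (-B) j = (-1 : ℂ) • B j := (neg_one_smul _ _).symm
    rw [congrArg (polyDot · _) h2, polyDot_smul, Polynomial.C_neg, Polynomial.C_1] at h1
    linear_combination h1
  refine Fin.addCases (fun j => ?_) (fun r => ?_) i
  · rw [extendRows_castAdd, extendRows_castAdd, key]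
  · rw [extendRows_natAdd, extendRows_natAdd, polyDot_sum, polyDot_sum, Finset.mul_sum]
    refine Finset.sum_congr rfl fun j _ => ?_
    rw [polyDot_smul, polyDot_smul, ← key]
    ring

/-- The rescaling `t ↦ δt` transfers independence and separability from the simpler pencil to the
secant curve. The point is that the new conditions no longer involve the solution of the system. -/
theorem isGeneral_extendRows {a : Fin 2 → Fin n → ℂ} {B : Matrix (Fin n) (Fin (n + 1)) ℂ}
    (hbase : ∀ i, extendRows a B i ⬝ᵥ Pi.single 0 1 ≠ 0)
    (hdet : (systemMatrix (extendRows a (coordRows n)) (extendRows a B)).det ≠ 0)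
    (hcoeff : (coeffMatrix (pencilCurve (coordRows n) (-B))).det ≠ 0)
    (hroots : ∀ i, (polyDot (extendRows a (coordRows n) i)
      (pencilCurve (coordRows n) (-B))).resultant (polyDot (extendRows a (coordRows n) i)
      (pencilCurve (coordRows n) (-B))).derivative (n - 1) (n - 1 - 1) ≠ 0) :
    IsGeneral (Pi.single 0 1) (extendRows a (coordRows n)) (extendRows a B) := by
  have hslope : ∀ i, systemSolution (extendRows a (coordRows n)) (extendRows a B) (Sum.inr i) ≠ 0 :=
    fun i => by rw [systemSolution_extendRows]; exact hdet
  have hminor : (topMinor (extendRows a (coordRows n))).det ≠ 0 := by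
    rw [topMinor_extendRows, Matrix.det_one]; exact one_ne_zero
  have hcomp := fun h => comp_secantCurve_extendRows a B h rfl
  have hdeg : ∀ k, (secantCurve (extendRows a (coordRows n)) (extendRows a B) k).natDegree ≤ n :=
    natDegree_pencilCurve_le _ _
  have hlead : leadVec (secantCurve (extendRows a (coordRows n)) (extendRows a B)) =
      Pi.single 0 1 := by
    rw [secantCurve, leadVec_pencilCurve, topRows_extendRows, maximalMinors_coordRows]
  have hlead' : leadVec (pencilCurve (coordRows n) (-B)) = Pi.single 0 1 := by
    rw [leadVec_pencilCurve, maximalMinors_coordRows]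
  refine ⟨hbase, hminor, hdet, hslope, ?_, fun i => ?_⟩
  · rw [det_coeffMatrix_ne_zero_iff hdeg]
    rw [det_coeffMatrix_ne_zero_iff (natDegree_pencilCurve_le _ _)] at hcoeff
    refine linearIndependent_of_polyDot fun h h0 => ?_
    have := hcomp h
    rw [h0, Polynomial.zero_comp, eq_comm, mul_eq_zero, Polynomial.C_eq_zero,
      or_iff_right (pow_ne_zero n hdet)] at this
    exact (polyDot_eq_zero_iff hcoeff h).1 this
  · obtain ⟨h1, h2⟩ := natDegree_of_mul_eq hdeg (by rw [hlead]; exact hbase i) (hslope i)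
      (secantCurve_mul_eq (p := Pi.single 0 1) (by simp) (extendRows_coordRows_dotProduct a)
        hminor i)
    -- For the simpler pencil the secancy identity holds with `τ = 0` and `μ = 1`.
    obtain ⟨h3, h4⟩ := natDegree_of_mul_eq (natDegree_pencilCurve_le _ _)
      (by rw [hlead']; exact hbase i) one_ne_zero (τ := 0)
      (by simpa using X_mul_polyDot_extendRows a B i)
    rw [resultant_derivative_ne_zero_iff h1 h2]
    exact separable_of_comp hdet (pow_ne_zero n hdet) (hcomp _)
      ((resultant_derivative_ne_zero_iff h3 h4).1 (hroots i))

end NormalForm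

theorem polyDot_single {n : ℕ} (k : Fin n) (φ : Fin n → Polynomial ℂ) :
    polyDot (Pi.single k 1) φ = φ k := by
  rw [polyDot, Finset.sum_eq_single k]
  · simp
  · intro j _ hj
    simp [Pi.single_eq_of_ne hj]
  · simp

/-! ### A member with a good curve: the diagonal pencil -/

section Diagonal

variable {n : ℕ}

/-- The forms `y₀ + dⱼ yⱼ`, which give the curve through the coordinate points. -/
def diagonalRows (d : Fin n → ℂ) : Matrix (Fin n) (Fin (n + 1)) ℂ :=
  fun j => Pi.single 0 1 + d j • Pi.single j.succ 1

theorem pencilCurve_diagonalRows_zero (d : Fin n → ℂ) :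
    pencilCurve (coordRows n) (-diagonalRows d) 0 =
      ∏ j, (Polynomial.X - Polynomial.C (d j)) := by
  rw [← Matrix.det_diagonal, pencilCurve_apply, Fin.val_zero, pow_zero, Polynomial.C_1, one_mul]
  congr 1
  ext1 i j
  by_cases h : i = j
  · subst h
    simp [coordRows_succ, diagonalRows, Fin.succ_ne_zero, sub_eq_add_neg]
  · simp [coordRows_succ, diagonalRows, Fin.succ_ne_zero, h]

/-- The kernel equation reads `(X - dⱼ) φⱼ₊₁ = φ₀`, and `φ₀` is the product of all the `X - dᵢ`. -/
theorem pencilCurve_diagonalRows_succ (d : Fin n → ℂ) (j : Fin n) :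
    pencilCurve (coordRows n) (-diagonalRows d) j.succ =
      ∏ i ∈ Finset.univ.erase j, (Polynomial.X - Polynomial.C (d i)) := by
  have h := X_mul_polyDot_extendRows (fun _ => 0) (diagonalRows d) (Fin.castAdd 2 j)
  rw [extendRows_castAdd, extendRows_castAdd, coordRows, diagonalRows, polyDot_add, polyDot_smul,
    polyDot_single, polyDot_single] at h
  change Polynomial.X * pencilCurve (coordRows n) (-diagonalRows d) j.succ =
    pencilCurve (coordRows n) (-diagonalRows d) 0 +
    Polynomial.C (d j) * pencilCurve (coordRows n) (-diagonalRows d) j.succ at h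
  rw [pencilCurve_diagonalRows_zero, ← Finset.mul_prod_erase _ _ (Finset.mem_univ j)] at h
  refine mul_left_cancel₀ (Polynomial.X_sub_C_ne_zero (d j)) ?_
  linear_combination h

theorem linearIndependent_pencilCurve_diagonalRows {d : Fin n → ℂ} (hd : Function.Injective d) :
    LinearIndependent ℂ (pencilCurve (coordRows n) (-diagonalRows d)) := by
  refine linearIndependent_of_polyDot fun c hc => ?_
  have hs : ∀ j : Fin n, c j.succ = 0 := by
    intro j
    -- At `dⱼ` every component vanishes except the one of index `j.succ`.
    have h := congrArg (Polynomial.eval (d j)) hc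
    rw [polyDot, Fin.sum_univ_succ, Polynomial.eval_add, Polynomial.eval_finsetSum,
      Finset.sum_eq_single j, pencilCurve_diagonalRows_zero, pencilCurve_diagonalRows_succ,
      Polynomial.eval_mul, Polynomial.eval_mul, Polynomial.eval_prod, Polynomial.eval_prod,
      Finset.prod_eq_zero (Finset.mem_univ j) (by simp), mul_zero, zero_add, Polynomial.eval_C,
      Polynomial.eval_zero, mul_eq_zero, Finset.prod_eq_zero_iff] at h
    · refine h.resolve_right ?_
      rintro ⟨i, hi, h0⟩
      rw [Polynomial.eval_sub, Polynomial.eval_X, Polynomial.eval_C, sub_eq_zero] at h0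
      exact Finset.ne_of_mem_erase hi (hd h0).symm
    · intro i _ hij
      rw [pencilCurve_diagonalRows_succ, Polynomial.eval_mul, Polynomial.eval_prod,
        Finset.prod_eq_zero (Finset.mem_erase.2 ⟨hij.symm, Finset.mem_univ j⟩) (by simp), mul_zero]
    · simp
  have h0 : c 0 = 0 := by
    rw [polyDot, Fin.sum_univ_succ, pencilCurve_diagonalRows_zero] at hc
    simp only [hs, Polynomial.C_0, zero_mul, Finset.sum_const_zero, add_zero, mul_eq_zero,
      Polynomial.C_eq_zero] at hc
    exact hc.resolve_right (Finset.prod_ne_zero_iff.2 fun j _ => Polynomial.X_sub_C_ne_zero _)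
  exact funext fun k => Fin.cases h0 hs k

theorem resultant_pencilCurve_diagonalRows {d : Fin n → ℂ} (hd : Function.Injective d)
    (j : Fin n) : (pencilCurve (coordRows n) (-diagonalRows d) j.succ).resultant
      (pencilCurve (coordRows n) (-diagonalRows d) j.succ).derivative (n - 1) (n - 1 - 1) ≠ 0 := by
  rw [resultant_derivative_ne_zero_iff, pencilCurve_diagonalRows_succ]
  · exact (Polynomial.separable_prod_X_sub_C_iff' (f := d)).2 fun x _ y _ h => hd h
  · rw [pencilCurve_diagonalRows_succ, Polynomial.natDegree_finsetProd_X_sub_C_eq_card]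
    simp
  · rw [pencilCurve_diagonalRows_succ]
    exact Finset.prod_ne_zero_iff.2 fun j _ => Polynomial.X_sub_C_ne_zero _

end Diagonal

/-! ### A member with an invertible system: permuted coordinates -/

section Permutation

variable {n : ℕ}

/-- The forms `δᵢⱼ y₀ + y_{s(j)}` attached to a permutation `s` and an index `i`. -/
def permRows (i : Fin n) (s : Equiv.Perm (Fin n)) : Matrix (Fin n) (Fin (n + 1)) ℂ :=
  fun j => (Pi.single i 1 : Fin n → ℂ) j • Pi.single 0 1 + Pi.single (s j).succ 1

theorem permRows_succ (i : Fin n) (s : Equiv.Perm (Fin n)) (j k : Fin n) :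
    permRows i s j k.succ = if s j = k then 1 else 0 := by
  simp [permRows, Pi.single_apply (s j).succ, Fin.succ_ne_zero, eq_comm (a := k)]

/-- Each coordinate meets few rows, so the homogeneous system can be solved by hand. The coordinate
`y₀` gives `μ' = 0`, and the relation with coefficients `1` expresses `τ` through `μ`. The relation
with coefficients `b` then kills `τ' 0` and `μ`, since `b` is nowhere zero and `b ∘ s` nowhere
equals `b`. -/
theorem det_systemMatrix_permRows_ne_zero {i : Fin n} (hi : Fin.castAdd 2 i = 0)
    {s : Equiv.Perm (Fin n)} {b : Fin n → ℂ} (hb : ∀ j, b j ≠ 0) (hbs : ∀ j, b (s j) ≠ b j) :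
    (systemMatrix (extendRows ![b, 1] (coordRows n))
      (extendRows ![b, 1] (permRows i s))).det ≠ 0 := by
  intro h0
  obtain ⟨z, hz, hz0⟩ := Matrix.exists_mulVec_eq_zero_iff.2 h0
  refine hz ?_
  rw [← Pi.single_zero (Sum.inr 0), systemMatrix_mulVec_eq_iff] at hz0
  obtain ⟨hτ, hμ, hrel⟩ := hz0
  set a : Fin 2 → Fin n → ℂ := ![b, 1] with ha
  set τ : Fin n → ℂ := fun j => z (Sum.inl (Fin.castAdd 2 j)) with hτd
  set μ : Fin n → ℂ := fun j => z (Sum.inr (Fin.castAdd 2 j)) with hμd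
  set τ' : Fin 2 → ℂ := fun r => z (Sum.inl (Fin.natAdd n r)) with hτ'd
  set μ' : Fin 2 → ℂ := fun r => z (Sum.inr (Fin.natAdd n r)) with hμ'd
  have hτ'1 : τ' 1 = 0 := hτ
  have hμi : μ i = 0 := by rw [hμd]; simp only [hi]; exact hμ
  have hrel' : ∀ r, ∑ j, a r j • ((τ j - τ' r) • coordRows n j +
      (μ j - μ' r) • permRows i s j) = 0 := by
    intro r
    refine Eq.trans ?_ (hrel r)
    rw [sum_formRelation_extendRows, extendRows_natAdd, extendRows_natAdd]
    simp only [extendRows_castAdd, Finset.smul_sum]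
    rw [← Finset.sum_add_distrib, ← Finset.sum_sub_distrib]
    refine Finset.sum_congr rfl fun j _ => ?_
    simp only [hτd, hμd, hτ'd, hμ'd]
    module
  have hzero : ∀ r, a r i * (μ i - μ' r) = 0 := by
    intro r
    have := congrFun (hrel' r) 0
    rw [Finset.sum_apply, Finset.sum_eq_single i] at this
    · simpa [coordRows_zero, permRows] using this
    · intro j _ hj
      simp [coordRows_zero, permRows, Pi.single_eq_of_ne hj]
    · simp
  -- The coordinate `y_{s(j)}` occurs only in the coordinate form of index `s j` and in the row `j`
  -- of `permRows i s`.
  have hsucc : ∀ r j, a r (s j) * (τ (s j) - τ' r) + a r j * (μ j - μ' r) = 0 := by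
    intro r j
    have := congrFun (hrel' r) (s j).succ
    simp only [Finset.sum_apply, Pi.smul_apply, Pi.add_apply, smul_eq_mul, mul_add,
      Finset.sum_add_distrib, coordRows_succ, permRows_succ, Pi.zero_apply] at this
    rw [Finset.sum_eq_single (s j), Finset.sum_eq_single j] at this
    · simpa using this
    · intro k _ hk
      simp [hk]
    · simp
    · intro k _ hk
      simp [Matrix.one_apply_ne hk]
    · simp
  have hμ'0 : ∀ r, μ' r = 0 := by
    intro r
    have h := hzero r
    rw [hμi, zero_sub, mul_neg, neg_eq_zero] at h
    fin_cases r
    · exact (mul_eq_zero.1 h).resolve_left (hb i)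
    · exact (mul_eq_zero.1 h).resolve_left one_ne_zero
  have h1 : ∀ j, τ (s j) = -μ j := by
    intro j
    have := hsucc 1 j
    change 1 * (τ (s j) - τ' 1) + 1 * (μ j - μ' 1) = 0 at this
    rw [hτ'1, hμ'0, sub_zero, sub_zero, one_mul, one_mul] at this
    exact eq_neg_of_add_eq_zero_left this
  have h2 : ∀ j, (b j - b (s j)) * μ j = b (s j) * τ' 0 := by
    intro j
    have := hsucc 0 j
    simp only [ha, hμ'0, sub_zero, Matrix.cons_val_zero, h1] at this
    linear_combination this
  -- At the index `i` the normalization gives `μ i = 0`, which isolates `τ' 0`.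
  have hτ'0 : τ' 0 = 0 := by
    have := h2 i
    rw [hμi, mul_zero] at this
    exact (mul_eq_zero.1 this.symm).resolve_left (hb _)
  have hμ0 : ∀ j, μ j = 0 := by
    intro j
    have := h2 j
    rw [hτ'0, mul_zero] at this
    exact (mul_eq_zero.1 this).resolve_left (sub_ne_zero.2 (hbs j).symm)
  have hτ0 : ∀ j, τ j = 0 := by
    intro j
    have := h1 (s.symm j)
    rwa [hμ0, neg_zero, s.apply_symm_apply] at this
  funext l
  rcases l with l | l
  · refine Fin.addCases hτ0 (fun r => ?_) l
    fin_cases r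
    · exact hτ'0
    · exact hτ'1
  · exact Fin.addCases hμ0 hμ'0 l

end Permutation

/-! ### Non-emptiness: interpolation along a line -/

/-- The ring of polynomial functions on `ℂ`. -/
noncomputable def lineFunctions : Subring (ℂ → ℂ) :=
  (RingHom.pi fun s : ℂ => Polynomial.evalRingHom s).range

theorem affine_mem_lineFunctions (u v : ℂ) : (fun s => u + s * (v - u)) ∈ lineFunctions :=
  ⟨Polynomial.C u + Polynomial.X * Polynomial.C (v - u), funext fun s => by simp⟩

theorem exists_ne_zero_and_ne_zero {f g : ℂ → ℂ} (hf : f ∈ lineFunctions)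
    (hg : g ∈ lineFunctions) {s t : ℂ} (hs : f s ≠ 0) (ht : g t ≠ 0) :
    ∃ u, f u ≠ 0 ∧ g u ≠ 0 := by
  obtain ⟨p, rfl⟩ := hf
  obtain ⟨q, rfl⟩ := hg
  by_contra! h
  have hpq : p * q = 0 := by
    refine Polynomial.funext fun u => ?_
    rw [Polynomial.eval_mul, Polynomial.eval_zero, mul_eq_zero, or_iff_not_imp_left]
    exact h u
  rcases mul_eq_zero.1 hpq with rfl | rfl
  · exact hs (by simp)
  · exact ht (by simp)

theorem extendRows_mem {α : Type*} {n : ℕ} (S : Subring (α → ℂ)) {a : α → Fin 2 → Fin n → ℂ}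
    {T : α → Matrix (Fin n) (Fin (n + 1)) ℂ} (ha : ∀ r j, (fun s => a s r j) ∈ S)
    (hT : ∀ j k, (fun s => T s j k) ∈ S) (i : Fin (n + 2)) (k : Fin (n + 1)) :
    (fun s => extendRows (a s) (T s) i k) ∈ S := by
  refine Fin.addCases (fun j => ?_) (fun r => ?_) i
  · simp only [extendRows, Fin.addCases_left]
    exact hT j k
  · simp only [extendRows, Fin.addCases_right]
    exact S.fun_dotProduct_mem (ha r) fun j => hT j k

theorem exists_isGeneral {n : ℕ} (hn : 2 ≤ n) :
    ∃ (p : Fin (n + 1) → ℂ) (H G : Fin (n + 2) → Fin (n + 1) → ℂ),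
      (∀ i, H i ⬝ᵥ p = 0) ∧ IsGeneral p H G := by
  obtain ⟨m, rfl⟩ := Nat.exists_eq_add_of_le' hn
  set n := m + 2
  let d : Fin n → ℂ := fun j => (j : ℕ)
  let b : Fin n → ℂ := fun j => (j : ℕ) + 1
  let cyc : Equiv.Perm (Fin n) := finRotate n
  -- With `a₁` the two extra rows repeat the row `0`, so the conditions at `s = 0` reduce to those
  -- on single rows of the diagonal pencil.
  let a₁ : Fin 2 → Fin n → ℂ := fun _ => Pi.single 0 1
  let a₂ : Fin 2 → Fin n → ℂ := ![b, 1]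
  let a : ℂ → Fin 2 → Fin n → ℂ := fun s r j => a₁ r j + s * (a₂ r j - a₁ r j)
  let B : ℂ → Matrix (Fin n) (Fin (n + 1)) ℂ := fun s j k =>
    diagonalRows d j k + s * (permRows 0 cyc j k - diagonalRows d j k)
  have ha : ∀ r j, (fun s => a s r j) ∈ lineFunctions := fun r j => affine_mem_lineFunctions _ _
  have hB : ∀ j k, (fun s => B s j k) ∈ lineFunctions := fun j k => affine_mem_lineFunctions _ _
  have hconst : ∀ c : ℂ, (fun _ => c) ∈ lineFunctions := fun c => by
    simpa using affine_mem_lineFunctions c c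
  have hE : ∀ j k, (fun _ : ℂ => coordRows n j k) ∈ lineFunctions := fun j k => hconst _
  have ha0 : a 0 = a₁ := by funext r j; simp [a]
  have ha1 : a 1 = a₂ := by funext r j; simp [a]
  have hB0 : B 0 = diagonalRows d := by ext j k; simp [B]
  have hB1 : B 1 = permRows 0 cyc := by ext j k; simp [B]
  have hH := extendRows_mem lineFunctions ha hE
  have hG := extendRows_mem lineFunctions ha hB
  have hΦ : ∀ k, (fun s => pencilCurve (coordRows n) (-B s) k) ∈
      lineFunctions.polynomialFamilies :=
    pencilCurve_mem lineFunctions hE fun j k => lineFunctions.neg_mem (hB j k)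
  have hdinj : Function.Injective d := fun i j h => Fin.ext (Nat.cast_injective h)
  let f : ℂ → ℂ := fun s => (∏ i, extendRows (a s) (B s) i ⬝ᵥ Pi.single 0 1) *
    (coeffMatrix (pencilCurve (coordRows n) (-B s))).det *
    ∏ i, (polyDot (extendRows (a s) (coordRows n) i)
      (pencilCurve (coordRows n) (-B s))).resultant (polyDot (extendRows (a s) (coordRows n) i)
      (pencilCurve (coordRows n) (-B s))).derivative (n - 1) (n - 1 - 1)
  have hf : f ∈ lineFunctions := by
    refine lineFunctions.mul_mem (lineFunctions.mul_mem ?_ (det_coeffMatrix_mem _ hΦ)) ?_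
    · exact lineFunctions.fun_prod_mem _ fun i _ =>
        lineFunctions.fun_dotProduct_mem (hG i) fun k => hconst _
    · exact lineFunctions.fun_prod_mem _ fun i _ =>
        lineFunctions.fun_resultant_mem (polyDot_mem _ (hH i) hΦ)
          (lineFunctions.fun_derivative_mem (polyDot_mem _ (hH i) hΦ)) _ _
  have hg : (fun s => (systemMatrix (extendRows (a s) (coordRows n))
      (extendRows (a s) (B s))).det) ∈ lineFunctions :=
    lineFunctions.fun_det_mem (systemMatrix_mem lineFunctions hH hG)
  have hrow : ∀ (T : Matrix (Fin n) (Fin (n + 1)) ℂ) (i : Fin (n + 2)),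
      ∃ j, extendRows a₁ T i = T j := by
    intro T i
    refine Fin.addCases (fun j => ⟨j, extendRows_castAdd _ _ j⟩) (fun r => ⟨0, ?_⟩) i
    rw [extendRows_natAdd, Finset.sum_eq_single 0]
    · simp [a₁]
    · intro j _ hj
      simp [a₁, Pi.single_eq_of_ne hj]
    · simp
  have hf0 : f 0 ≠ 0 := by
    simp only [f, ha0, hB0]
    refine mul_ne_zero (mul_ne_zero ?_ ?_) ?_
    · refine Finset.prod_ne_zero_iff.2 fun i _ => ?_
      obtain ⟨j, hj⟩ := hrow (diagonalRows d) i
      rw [hj, dotProduct_single_one]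
      simp [diagonalRows, (Fin.succ_ne_zero j).symm]
    · rw [det_coeffMatrix_ne_zero_iff (natDegree_pencilCurve_le _ _)]
      exact linearIndependent_pencilCurve_diagonalRows hdinj
    · refine Finset.prod_ne_zero_iff.2 fun i _ => ?_
      obtain ⟨j, hj⟩ := hrow (coordRows n) i
      rw [ha0, hB0, hj, coordRows, polyDot_single]
      exact resultant_pencilCurve_diagonalRows hdinj j
  -- The curve conditions hold at `s = 0` and the system is invertible at `s = 1`; both are
  -- polynomial in `s`. A rotation of at least two indices has no fixed point, so `b` changes along
  -- it.
  obtain ⟨s, hfs, hgs⟩ := exists_ne_zero_and_ne_zero hf hg (s := 0) (t := 1) hf0 (by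
    simp only [ha1, hB1]
    refine det_systemMatrix_permRows_ne_zero rfl (fun j => ?_) (fun j => ?_)
    · exact Nat.cast_add_one_ne_zero _
    · intro h
      have h1 : finRotate (m + 2) j = j :=
        Fin.ext (Nat.cast_injective (R := ℂ) (add_right_cancel h))
      rw [finRotate_apply] at h1
      simp at h1)
  simp only [f, mul_ne_zero_iff, Finset.prod_ne_zero_iff, Finset.mem_univ, true_imp_iff] at hfs
  exact ⟨_, _, _, extendRows_coordRows_dotProduct (a s),
    isGeneral_extendRows hfs.1.1 hgs hfs.1.2 hfs.2⟩

theorem proposition4p6 (n : ℕ) (hn : 2 ≤ n) :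
    ∃ U : Set (Datum n (n + 2)), IsOpen[zariskiDatum n (n + 2)] U ∧ U.Nonempty ∧
      ∀ δ ∈ U, ∃! C : Set (PSpace n),
        IsRationalNormalCurve n C ∧ δ.2 ∈ C ∧ ∀ i, IsSecant (δ.1 i) C := by
  obtain ⟨f, hf, hgen⟩ := exists_ne_zero_iff_isGeneral_frame n
  refine ⟨_, isOpen_setOf_exists_frame hf, ?_, ?_⟩
  · obtain ⟨p, H, G, hH, h⟩ := exists_isGeneral hn
    obtain ⟨x, hx, hxH, hxG⟩ := h.exists_frame hn hH
    refine ⟨x.toDatum, x, (hgen x.1).2 ?_, rfl⟩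
    rwa [hx, hxH, hxG]
  · rintro _ ⟨x, hx, rfl⟩
    have h := (hgen x.1).1 hx
    exact existsUnique_of_isGeneral (one_le_two.trans hn) (frameH_dotProduct_framePoint x.1) h
      (Projectivization.submodule_mk _ _) fun i v => mem_toDatum_iff x i (h.base i) v
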